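/- Let $n\ge 1$ and $p$ be integers, $\lambda,\kappa\ge 0$, and let $\mathcal G$ be an undirected graph on $V=\{1,\dots,p\}$; write $\mathrm{bd}(i)$ for the set of neighbours of $i$. For $Y\in\mathbb R^{n\times p}$ put $S=\frac1nY^\top Y$, $S^{(\kappa)}=S+\kappa I_p$, $Y^{(\kappa)}=(Y^\top,\sqrt{n\kappa}\,I_p)^\top$, and $$F(\Sigma)=\ell_Y(\Sigma)-\mathcal P_{\lambda,\kappa}(\Sigma)=-\log|\Sigma|-\mathrm{tr}(\Sigma^{-1}S)-\lambda\sum_{j\ne k}|\sigma_{jk}|-\kappa\sum_j(\Sigma^{-1})_{jj}.$$ Let $\mathcal S_\succ(\mathcal G)$ be the cone of positive definite matrices $\Sigma$ with $\sigma_{jk}=0$ whenever $j\neq k$ are not adjacent in $\mathcal G$. The GICF algorithm starts from a positive definite $\widehat\Sigma^{(0)}$ and produces $\widehat\Sigma^{(r)}$ from $\widehat\Sigma^{(r-1)}$ by running through $i=1,\dots,p$, each time replacing the $i$-th row and column of the current matrix $\Sigma$ as follows. Let $y$ be the $i$-th column of $Y^{(\kappa)}$, $Z$ the submatrix of $Y^{(\kappa)}_{-i}(\Sigma_{-i,-i})^{-1}$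 of the columns in $\mathrm{bd}(i)$, and $\beta=(\sigma_{ji})_{j\in\mathrm{bd}(i)}$. If $\mathrm{bd}(i)=\emptyset$, put $\tau=\frac1n\|y\|_2^2$. Otherwise repeat passes of the following form: put $\tau=\frac1n\|y-Z\beta\|_2^2$, and then, for $j\in\mathrm{bd}(i)$ in increasing order, replace $\beta_j$ by $\frac1{C_j}\,\mathrm{sign}(B_j)(|B_j|-\lambda)_+$, where $B_j=\frac1{n\tau}\big([Z^\top y]_j-\sum_{m\ne j}[Z^\top Z]_{jm}\beta_m\big)$ and $C_j=\frac1{n\tau}[Z^\top Z]_{jj}$. The output $(\tau,\beta)$ of this loop is either its state after some number (at least one) of passes, which may differ from call to call, or the limit of its states when it is run to exact convergence. Finally set $\sigma_{ji}=\sigma_{ij}=\beta_j$ for $j\in\mathrm{bd}(i)$, $\sigma_{ji}=\sigma_{ij}=0$ for the other $j\ne i$, and $\sigma_{ii}=\tau+\sigma_{-i,i}^\top(\Sigma_{-i,-i})^{-1}\sigma_{-i,i}$. (i) If $\kappa>0$, then $S^{(\kappa)}$ is positive definite for every $Y$. If $n>p$ and the rows of $Y$ are independent $N(0,\Sigma_0)$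 vectors with $\Sigma_0$ positive definite, then $S^{(\kappa)}$ is positive definite with probability one. (ii) Let $Y$ be such that $S^{(\kappa)}$ is positive definite, and let $(\widehat\Sigma^{(r)})_{r\in\mathbb N}$ be a sequence produced by GICF from a positive definite $\widehat\Sigma^{(0)}$. Then every accumulation point $\Sigma^*$ of this sequence is a directional stationary point of $F$ over $\mathcal S_\succ(\mathcal G)$, that is, $\Sigma^*\in\mathcal S_\succ(\mathcal G)$ and, for every $\Sigma'\in\mathcal S_\succ(\mathcal G)$, the one-sided directional derivative of $F$ at $\Sigma^*$ in the direction $\Sigma'-\Sigma^*$ exists and is at most $0$; if $\lambda=0$, then $\Sigma^*$ is also a stationary point in the classical sense: the derivative of $F$ at $\Sigma^*$ within $\mathcal S_\succ(\mathcal G)$ is zero. Moreover, the sequence of values $F(\widehat\Sigma^{(r)})$ converges to a finite limit. -/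

import Mathlib

open Matrix Filter Topology MeasureTheory ProbabilityTheory

noncomputable section

/-! ### Penalized Gaussian likelihood of a sparse covariance matrix -/

/-- `S = (1/n) Yᵀ Y`. -/
def sampleCov {n p : ℕ} (Y : Matrix (Fin n) (Fin p) ℝ) : Matrix (Fin p) (Fin p) ℝ :=
  (1 / (n : ℝ)) • (Yᵀ * Y)

/-- `S + κ I`. -/
def ridgeCov {n p : ℕ} (Y : Matrix (Fin n) (Fin p) ℝ) (κ : ℝ) : Matrix (Fin p) (Fin p) ℝ :=
  sampleCov Y + κ • (1 : Matrix (Fin p) (Fin p) ℝ)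

/-- The Gaussian loglikelihood `-log |Σ| - tr (Σ⁻¹ S)`. -/
def gaussLogLik {n p : ℕ} (Y : Matrix (Fin n) (Fin p) ℝ) (A : Matrix (Fin p) (Fin p) ℝ) : ℝ :=
  -Real.log A.det - (A⁻¹ * sampleCov Y).trace

/-- The penalty `λ ∑_{j ≠ k} |σ_jk| + κ ∑_j (Σ⁻¹)_jj`. -/
def ridgeLassoPenalty {p : ℕ} (lam κ : ℝ) (A : Matrix (Fin p) (Fin p) ℝ) : ℝ :=
  lam * (∑ j, ∑ k, if j ≠ k then |A j k| else 0) + κ * ∑ j, A⁻¹ j j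

/-- The objective function `ℓ_Y(Σ) - P_{λ,κ}(Σ)`, to be maximized. -/
def penObjective {n p : ℕ} (Y : Matrix (Fin n) (Fin p) ℝ) (lam κ : ℝ)
    (A : Matrix (Fin p) (Fin p) ℝ) : ℝ :=
  gaussLogLik Y A - ridgeLassoPenalty lam κ A

/-- The cone of positive definite matrices adapted to the graph `G`. -/
def adaptedCone {p : ℕ} (G : SimpleGraph (Fin p)) : Set (Matrix (Fin p) (Fin p) ℝ) :=
  {A | A.PosDef ∧ ∀ j k, j ≠ k → ¬ G.Adj j k → A j k = 0}

/-! ### Stationarity -/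

/-- Directional stationarity of `x` for the maximization of `f` over a convex set `s`: `x ∈ s` and,
for each `y ∈ s`, the one-sided directional derivative of `f` at `x` in the direction `y - x` exists
and is nonpositive. -/
def IsDStationaryMax {E : Type*} [AddCommGroup E] [Module ℝ E] (f : E → ℝ) (s : Set E) (x : E) :
    Prop :=
  x ∈ s ∧ ∀ y ∈ s, ∃ d : ℝ, d ≤ 0 ∧
    Tendsto (fun t : ℝ => (f (x + t • (y - x)) - f x) / t) (𝓝[>] 0) (𝓝 d)

/-! ### Coordinate descent for the lasso regression with unknown error variance -/

/-- Soft-thresholding `sign(x) (|x| - λ)₊`. -/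
def softThreshold (lam x : ℝ) : ℝ := Real.sign x * max (|x| - lam) 0

section CoordinateDescent

variable {m J : Type*} [Fintype m] [Fintype J] [LinearOrder J]

/-- `τ = (1/n) ‖y - Z β‖²`; here `n` is a free parameter, not the number of rows of `Z`. -/
def cdTau (n : ℕ) (y : m → ℝ) (Z : Matrix m J ℝ) (b : J → ℝ) : ℝ :=
  (1 / (n : ℝ)) * ∑ k, (y k - (Z *ᵥ b) k) ^ 2

/-- The update of the single coordinate `j` of `b`, for a given error variance `τ`. -/
def cdCoord (n : ℕ) (y : m → ℝ) (Z : Matrix m J ℝ) (lam τ : ℝ) (b : J → ℝ) (j : J) : J → ℝ :=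
  let B : ℝ := 1 / ((n : ℝ) * τ) *
    ((Zᵀ *ᵥ y) j - ∑ l ∈ Finset.univ.erase j, (Zᵀ * Z) j l * b l)
  let C : ℝ := 1 / ((n : ℝ) * τ) * (Zᵀ * Z) j j
  Function.update b j (1 / C * softThreshold lam B)

/-- One pass: compute `τ` from `b`, then update all the coordinates of `b`, in increasing order. -/
def cdPass (n : ℕ) (y : m → ℝ) (Z : Matrix m J ℝ) (lam : ℝ) (b : J → ℝ) : J → ℝ :=
  ((Finset.univ : Finset J).sort (· ≤ ·)).foldl (cdCoord n y Z lam (cdTau n y Z b)) b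

/-- The regression coefficients after `r` passes from the starting point `b₀`. -/
def cdIter (n : ℕ) (y : m → ℝ) (Z : Matrix m J ℝ) (lam : ℝ) (b₀ : J → ℝ) (r : ℕ) : J → ℝ :=
  (cdPass n y Z lam)^[r] b₀

/-- `(τ, b)` after pass number `r + 1`; `τ` was computed at the start of that pass. -/
def cdState (n : ℕ) (y : m → ℝ) (Z : Matrix m J ℝ) (lam : ℝ) (b₀ : J → ℝ) (r : ℕ) :
    ℝ × (J → ℝ) :=
  (cdTau n y Z (cdIter n y Z lam b₀ r), cdIter n y Z lam b₀ (r + 1))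

/-- `out = (τ, b)` is a possible output of the coordinate-descent procedure started at `b₀`: it is
either the state in which the loop is stopped after some number (at least one) of passes, whatever
the stopping rule, or the limit of the states when the loop is run to exact convergence. -/
def IsCDOutput (n : ℕ) (y : m → ℝ) (Z : Matrix m J ℝ) (lam : ℝ) (b₀ : J → ℝ)
    (out : ℝ × (J → ℝ)) : Prop :=
  (∃ r : ℕ, out = cdState n y Z lam b₀ r) ∨ Tendsto (cdState n y Z lam b₀) atTop (𝓝 out)

end CoordinateDescent

/-! ### The algorithm (generalized iterative conditional fitting) -/

/-- The extended data matrix `(Yᵀ, √(n κ) I)ᵀ`. -/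
def extData {n p : ℕ} (Y : Matrix (Fin n) (Fin p) ℝ) (κ : ℝ) :
    Matrix (Fin n ⊕ Fin p) (Fin p) ℝ :=
  Matrix.fromRows Y (Real.sqrt ((n : ℝ) * κ) • (1 : Matrix (Fin p) (Fin p) ℝ))

/-- `Σ_{-i,-i}`: the matrix without row and column `i`. -/
def dropIdx {p : ℕ} (A : Matrix (Fin p) (Fin p) ℝ) (i : Fin p) :
    Matrix {j : Fin p // j ≠ i} {j : Fin p // j ≠ i} ℝ :=
  A.submatrix Subtype.val Subtype.val

/-- The boundary `bd(i)` of the vertex `i`. -/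
abbrev Bd {p : ℕ} (G : SimpleGraph (Fin p)) (i : Fin p) : Type := {j : Fin p // G.Adj i j}

/-- The inclusion of `bd(i)` into `V \ {i}`. -/
def Bd.incl {p : ℕ} (G : SimpleGraph (Fin p)) (i : Fin p) (j : Bd G i) : {j : Fin p // j ≠ i} :=
  ⟨j.1, (G.ne_of_adj j.2).symm⟩

/-- The pseudo-predictors: the columns in `bd(i)` of `Y^(κ)_{-i} (Σ_{-i,-i})⁻¹`. -/
def pseudoPred {n p : ℕ} (Y : Matrix (Fin n) (Fin p) ℝ) (κ : ℝ) (G : SimpleGraph (Fin p))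
    (A : Matrix (Fin p) (Fin p) ℝ) (i : Fin p) : Matrix (Fin n ⊕ Fin p) (Bd G i) ℝ :=
  ((extData Y κ).submatrix id (Subtype.val : {j : Fin p // j ≠ i} → Fin p) *
    (dropIdx A i)⁻¹).submatrix id (Bd.incl G i)

/-- A vector on `bd(i)`, filled with zeros to a vector on `V \ {i}`. -/
def Bd.extend {p : ℕ} (G : SimpleGraph (Fin p)) [DecidableRel G.Adj] (i : Fin p)
    (b : Bd G i → ℝ) : {j : Fin p // j ≠ i} → ℝ :=
  fun j => if h : G.Adj i j.1 then b ⟨j.1, h⟩ else 0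

/-- The matrix obtained from `A` by replacing the off-diagonal part of row and column `i` by `s` and
the diagonal entry `(i, i)` by `τ + sᵀ (Σ_{-i,-i})⁻¹ s`. -/
def replaceIdx {p : ℕ} (A : Matrix (Fin p) (Fin p) ℝ) (i : Fin p) (τ : ℝ)
    (s : {j : Fin p // j ≠ i} → ℝ) : Matrix (Fin p) (Fin p) ℝ :=
  Matrix.of fun a b =>
    if ha : a = i then
      if hb : b = i then τ + s ⬝ᵥ ((dropIdx A i)⁻¹ *ᵥ s) else s ⟨b, hb⟩
    else
      if b = i then s ⟨a, ha⟩ else A a b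

/-- `A'` results from `A` by the update of the vertex `i`. -/
def IsVertexUpdate {n p : ℕ} (Y : Matrix (Fin n) (Fin p) ℝ) (lam κ : ℝ)
    (G : SimpleGraph (Fin p)) [DecidableRel G.Adj] (i : Fin p)
    (A A' : Matrix (Fin p) (Fin p) ℝ) : Prop :=
  ∃ (τ : ℝ) (b : Bd G i → ℝ),
    (Nonempty (Bd G i) →
      IsCDOutput n (fun k => extData Y κ k i) (pseudoPred Y κ G A i) lam
        (fun j => A j.1 i) (τ, b)) ∧
    (IsEmpty (Bd G i) → τ = (1 / (n : ℝ)) * ∑ k, extData Y κ k i * extData Y κ k i) ∧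
    A' = replaceIdx A i τ (Bd.extend G i b)

/-- `A'` results from `A` by one iteration of the main loop: the vertices are updated in turn. -/
def IsSweep {n p : ℕ} (Y : Matrix (Fin n) (Fin p) ℝ) (lam κ : ℝ)
    (G : SimpleGraph (Fin p)) [DecidableRel G.Adj]
    (A A' : Matrix (Fin p) (Fin p) ℝ) : Prop :=
  ∃ W : Fin (p + 1) → Matrix (Fin p) (Fin p) ℝ,
    W 0 = A ∧ W (Fin.last p) = A' ∧
    ∀ i : Fin p, IsVertexUpdate Y lam κ G i (W i.castSucc) (W i.succ)

/-- `E` is a sequence of estimates produced by the algorithm, with starting value `E 0`. -/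
def IsGICFSequence {n p : ℕ} (Y : Matrix (Fin n) (Fin p) ℝ) (lam κ : ℝ)
    (G : SimpleGraph (Fin p)) [DecidableRel G.Adj]
    (E : ℕ → Matrix (Fin p) (Fin p) ℝ) : Prop :=
  ∀ r : ℕ, IsSweep Y lam κ G (E r) (E (r + 1))

/-! ### Gaussian samples -/

/-- `X` is a sample of size `n` of independent random vectors with law `N(0, Σ₀)`. -/
def IsGaussianSample {n p : ℕ} {Ω : Type*} [MeasurableSpace Ω] (P : Measure Ω)
    (Sigma₀ : Matrix (Fin p) (Fin p) ℝ) (X : Fin n → Ω → EuclideanSpace ℝ (Fin p)) : Prop :=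
  (∀ k, HasLaw (X k) (multivariateGaussian 0 Sigma₀) P) ∧ iIndepFun X P

/-- The data matrix whose rows are the sample vectors. -/
def dataMatrix {n p : ℕ} {Ω : Type*} (X : Fin n → Ω → EuclideanSpace ℝ (Fin p)) (ω : Ω) :
    Matrix (Fin n) (Fin p) ℝ :=
  Matrix.of fun k j => X k ω j

end

noncomputable section

/-! ### Positive definiteness of the regularized sample covariance matrix -/

/-! Positive definiteness is clear when `κ > 0`. Otherwise injectivity of `Y` suffices, and the
first `p` Gaussian rows are almost surely independent, because a nondegenerate Gaussian measure does
not charge the span of fewer than `p` vectors.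

For the convergence, describe `Σ` by the block `Σ_{-i,-i}`, the column `i` and the Schur complement
`τ`. With the block fixed, `F` is a constant minus the lasso objective `log τ + ‖y - Zβ‖²/(nτ) +
2λ∑|β_j|` (`exists_penObjective_replaceIdx`), and a pass minimizes this exactly in `τ` and then in
each `β_j`. Every one-dimensional minimizer is unique, so a pass never decreases `F`, and keeps its
value only at a fixed point (`penObjective_passMap`). As `S^(κ)` is positive definite, `F` is
bounded above and has compact superlevel sets (`isCompact_superlevel`); hence the values converge.

The obstacle is that a vertex update iterates the continuous pass an uncontrolled, possibly infinite
number of times, so a vanishing gain in `F` does not by itself bound the displacement. If the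
outputs had a limit other than that of the starting points, the orbits would cross every small
sphere around the latter in a single step, and the crossing points would accumulate at a fixed point
on each sphere (`IsOrbitOutput.tendsto_of_finite_fixedPoints`). This is impossible, because a given
block `Σ_{-i,-i}` admits only finitely many fixed points (`finite_setOf_cdPass_eq_self`). So all
intermediate matrices of a sweep tend to the same accumulation point, and every pass fixes it.

At such a point `F` is maximal in each parameter separately. Since `F` is a differentiable function
minus a penalty separable in the entries, the inequalities for single coordinates add up to
directional stationarity. -/

theorem sampleCov_posSemidef {n p : ℕ} (Y : Matrix (Fin n) (Fin p) ℝ) :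
    (sampleCov Y).PosSemidef := by
  have h := Matrix.posSemidef_conjTranspose_mul_self Y
  rw [conjTranspose_eq_transpose_of_trivial] at h
  exact h.smul (by positivity)

theorem ridgeCov_posDef_of_pos {n p : ℕ} (Y : Matrix (Fin n) (Fin p) ℝ) {κ : ℝ} (hκ : 0 < κ) :
    (ridgeCov Y κ).PosDef :=
  (PosDef.one.smul hκ).posSemidef_add (sampleCov_posSemidef Y)

theorem ridgeCov_posDef_of_injective {n p : ℕ} (hn : 0 < n) (Y : Matrix (Fin n) (Fin p) ℝ)
    {κ : ℝ} (hκ : 0 ≤ κ) (hY : Function.Injective Y.mulVec) : (ridgeCov Y κ).PosDef := by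
  have h := PosDef.conjTranspose_mul_self Y hY
  rw [conjTranspose_eq_transpose_of_trivial] at h
  have hn' : (0 : ℝ) < 1 / (n : ℝ) := by positivity
  exact (h.smul hn').add_posSemidef (PosSemidef.one.smul hκ)

/-- A nondegenerate Gaussian measure does not charge proper subspaces. -/
theorem multivariateGaussian_submodule_eq_zero {p : ℕ} {S : Matrix (Fin p) (Fin p) ℝ}
    (hS : S.PosDef) (V : Submodule ℝ (EuclideanSpace ℝ (Fin p))) (hV : V ≠ ⊤) :
    multivariateGaussian 0 S (V : Set (EuclideanSpace ℝ (Fin p))) = 0 := by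
  -- A nonzero `u` orthogonal to `V` puts `V` inside a hyperplane. The image measure under `⟨u, ·⟩`
  -- is a real Gaussian of variance `uᵀ S u > 0`, so it has no atoms.
  have hV' : Vᗮ ≠ ⊥ := fun h => hV ((Submodule.orthogonal_eq_bot_iff).1 h)
  obtain ⟨u, huV, hu⟩ := Submodule.exists_mem_ne_zero_of_ne_bot hV'
  set μ := multivariateGaussian (0 : EuclideanSpace ℝ (Fin p)) S with hμ
  have hsub : (V : Set (EuclideanSpace ℝ (Fin p))) ⊆ (innerSL ℝ u) ⁻¹' {0} := by
    intro x hx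
    simpa using Submodule.inner_left_of_mem_orthogonal hx huV
  refine measure_mono_null hsub ?_
  rw [← Measure.map_apply (by fun_prop) (measurableSet_singleton _),
    IsGaussian.map_eq_gaussianReal]
  have hvar : 0 < Var[innerSL ℝ u; μ] := by
    have h1 : Var[innerSL ℝ u; μ] = covarianceBilin μ u u := by
      rw [covarianceBilin_self (IsGaussian.memLp_two_id)]
      rfl
    rw [h1, hμ, covarianceBilin_multivariateGaussian hS.posSemidef]
    have := hS.dotProduct_mulVec_pos (x := u.ofLp) (by
      intro h; apply hu; ext i; simpa using congrFun h i)
    simpa using this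
  have := nullSingletonClass_gaussianReal (μ := ∫ x, (innerSL ℝ u) x ∂μ)
    (v := (Var[innerSL ℝ u; μ]).toNNReal) (by simpa using hvar)
  exact measure_singleton _

/-- Independent draws from a measure that does not charge proper subspaces are almost surely
linearly independent, as long as there are no more draws than dimensions. -/
theorem ae_pi_linearIndependent {E : Type*} [NormedAddCommGroup E] [NormedSpace ℝ E]
    [FiniteDimensional ℝ E] [MeasurableSpace E] [BorelSpace E] (μ : Measure E)
    [IsProbabilityMeasure μ]
    (hμ : ∀ V : Submodule ℝ E, V ≠ ⊤ → μ (V : Set E) = 0) (k : ℕ)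
    (hk : k ≤ Module.finrank ℝ E) :
    ∀ᵐ v ∂(Measure.pi fun _ : Fin k => μ), LinearIndependent ℝ v := by
  have : SecondCountableTopology E := secondCountable_of_proper
  induction k with
  | zero => exact Eventually.of_forall fun v => linearIndependent_empty_type
  | succ k ih =>
    have ih := ih (by omega)
    have hmp := measurePreserving_piFinSuccAbove (fun _ : Fin (k + 1) => μ) 0
    have hopen : MeasurableSet {v : Fin (k + 1) → E | LinearIndependent ℝ v} :=
      isOpen_setOfPred_linearIndependent.measurableSet
    have hmeas : MeasurableSet {q : E × (Fin k → E) |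
        ¬ LinearIndependent ℝ (Fin.cons q.1 q.2 : Fin (k + 1) → E)} := by
      have hc : Measurable fun q : E × (Fin k → E) => (Fin.cons q.1 q.2 : Fin (k + 1) → E) := by
        refine measurable_pi_lambda _ fun i => ?_
        refine Fin.cases ?_ (fun j => ?_) i
        · simpa using measurable_fst
        · simpa using! (measurable_pi_apply j).comp measurable_snd
      exact (hc hopen).compl
    have hprod : ∀ᵐ q ∂(μ.prod (Measure.pi fun _ : Fin k => μ)),
        LinearIndependent ℝ (Fin.cons q.1 q.2 : Fin (k + 1) → E) := by
      rw [ae_iff]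
      -- Swapping the factors makes the new vector the inner variable in Fubini's theorem: it has to
      -- avoid the span of the `k` earlier vectors, held fixed.
      have hsw : Measure.map Prod.swap ((Measure.pi fun _ : Fin k => μ).prod μ) =
        μ.prod (Measure.pi fun _ : Fin k => μ) := Measure.prod_swap
      rw [← hsw, Measure.map_apply measurable_swap hmeas,
        Measure.measure_prod_null (measurable_swap hmeas)]
      filter_upwards [ih] with v hv
      have hspan : Submodule.span ℝ (Set.range v) ≠ ⊤ := by
        intro h
        have h1 := finrank_range_le_card (R := ℝ) v
        rw [Set.finrank, h, finrank_top, Fintype.card_fin] at h1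
        omega
      refine measure_mono_null ?_ (hμ _ hspan)
      intro x hx
      by_contra hxs
      exact hx (linearIndependent_finCons.2 ⟨hv, hxs⟩)
    have h2 := hmp.quasiMeasurePreserving.ae hprod
    filter_upwards [h2] with v hv
    have hv' : (Fin.cons (v 0) (fun j => v (Fin.succ j)) : Fin (k + 1) → E) = v :=
      Fin.cons_self_tail v
    rw [← hv']
    exact hv

theorem ridgeCov_dataMatrix_posDef_ae {n p : ℕ} (hn : 0 < n) (hpn : p < n) {κ : ℝ} (hκ : 0 ≤ κ)
    {Ω : Type*} [MeasurableSpace Ω] (P : Measure Ω) [IsProbabilityMeasure P]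
    (S : Matrix (Fin p) (Fin p) ℝ) (X : Fin n → Ω → EuclideanSpace ℝ (Fin p)) (hS : S.PosDef)
    (hX : IsGaussianSample P S X) : ∀ᵐ ω ∂P, (ridgeCov (dataMatrix X ω) κ).PosDef := by
  obtain ⟨hlaw, hind⟩ := hX
  -- The first `p` rows suffice: they form a square submatrix that is almost surely invertible.
  have hind' := hind.precomp (Fin.castLE_injective hpn.le)
  have hmap := (iIndepFun_iff_map_fun_eq_pi_map
    (fun i : Fin p => (hlaw (Fin.castLE hpn.le i)).aemeasurable)).1 hind'
  have hli := ae_pi_linearIndependent (multivariateGaussian (0 : EuclideanSpace ℝ (Fin p)) S)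
    (multivariateGaussian_submodule_eq_zero hS) p (by simp)
  have hpi : (Measure.pi fun i : Fin p => P.map (X (Fin.castLE hpn.le i))) =
      Measure.pi fun _ : Fin p => multivariateGaussian (0 : EuclideanSpace ℝ (Fin p)) S := by
    congr 1; funext i; exact (hlaw _).map_eq
  rw [← hpi, ← hmap] at hli
  have hli' := ae_of_ae_map (aemeasurable_pi_lambda _
    fun i : Fin p => (hlaw (Fin.castLE hpn.le i)).aemeasurable) hli
  filter_upwards [hli'] with ω hω
  refine ridgeCov_posDef_of_injective hn _ hκ ?_
  have hinj : Function.Injective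
      ((dataMatrix X ω).submatrix (Fin.castLE hpn.le) id).mulVec := by
    rw [mulVec_injective_iff_isUnit, ← linearIndependent_rows_iff_isUnit]
    exact hω.map' (WithLp.linearEquiv 2 ℝ (Fin p → ℝ)).toLinearMap (LinearEquiv.ker _)
  intro x y hxy
  apply hinj
  funext i
  exact congrFun hxy (Fin.castLE hpn.le i)

/-! ### Coordinate descent -/

/-- Subgradient conditions for `C s² - 2 B s + 2 lam |s|`: `B - C s` lies in `lam ∂|·|(s)`. A bound
and a product identity express this without reference to the sign of `s`. -/
theorem softThreshold_optimality {lam C : ℝ} (hlam : 0 ≤ lam) (hC : 0 < C) (B : ℝ) :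
    |B - C * (1 / C * softThreshold lam B)| ≤ lam ∧
      (B - C * (1 / C * softThreshold lam B)) * (1 / C * softThreshold lam B) =
        lam * |1 / C * softThreshold lam B| := by
  have h1 : C * (1 / C * softThreshold lam B) = softThreshold lam B := by field_simp
  rw [h1, abs_mul, abs_of_pos (by positivity : 0 < 1 / C)]
  suffices h : |B - softThreshold lam B| ≤ lam ∧
      (B - softThreshold lam B) * softThreshold lam B = lam * |softThreshold lam B| by
    refine ⟨h.1, ?_⟩
    linear_combination (1 / C) * h.2
  unfold softThreshold
  rcases lt_trichotomy B 0 with hB | hB | hB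
  · rw [Real.sign_of_neg hB, abs_of_neg hB]
    rcases le_total (-B - lam) 0 with h | h
    · rw [max_eq_right h]; simp [abs_of_neg hB]; linarith
    · rw [max_eq_left h, abs_of_nonpos (by linarith : -1 * (-B - lam) ≤ 0)]
      refine ⟨abs_le.2 ⟨by linarith, by linarith⟩, by ring⟩
  · subst hB; simp [hlam]
  · rw [Real.sign_of_pos hB, abs_of_pos hB]
    rcases le_total (B - lam) 0 with h | h
    · rw [max_eq_right h]; simp [abs_of_pos hB]; linarith
    · rw [max_eq_left h, abs_of_nonneg (by linarith : 0 ≤ 1 * (B - lam))]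
      refine ⟨abs_le.2 ⟨by linarith, by linarith⟩, by ring⟩

/-- The jump of `Real.sign` at `0` disappears in the product: for `lam ≥ 0` the function is a
difference of two positive parts. -/
theorem continuous_softThreshold {lam : ℝ} (hlam : 0 ≤ lam) : Continuous (softThreshold lam) := by
  have : softThreshold lam = fun x => max (x - lam) 0 - max (-x - lam) 0 := by
    funext x
    unfold softThreshold
    rcases lt_trichotomy x 0 with hx | hx | hx
    · rw [Real.sign_of_neg hx, abs_of_neg hx, max_eq_right (by linarith : x - lam ≤ 0)]; ring
    · subst hx; simp
    · rw [Real.sign_of_pos hx, abs_of_pos hx, max_eq_right (by linarith : -x - lam ≤ 0)]; ring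
  rw [this]
  fun_prop

/-- The soft-thresholded value is the unique minimizer of the one-dimensional lasso problem. -/
theorem softThreshold_minimizes {lam C : ℝ} (hlam : 0 ≤ lam) (hC : 0 < C) (B t : ℝ) :
    C * (1 / C * softThreshold lam B) ^ 2 - 2 * B * (1 / C * softThreshold lam B) +
      2 * lam * |1 / C * softThreshold lam B| + C * (t - 1 / C * softThreshold lam B) ^ 2 ≤
    C * t ^ 2 - 2 * B * t + 2 * lam * |t| := by
  obtain ⟨h1, h2⟩ := softThreshold_optimality hlam hC B
  set s := 1 / C * softThreshold lam B
  have h3 : (B - C * s) * t ≤ lam * |t| := by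
    calc (B - C * s) * t ≤ |(B - C * s) * t| := le_abs_self _
      _ = |B - C * s| * |t| := abs_mul _ _
      _ ≤ lam * |t| := by gcongr
  nlinarith

section

variable {m J : Type*} [Fintype m] [Fintype J] [LinearOrder J]

/-- The objective of the lasso regression with unknown error variance. -/
def cdObj (n : ℕ) (y : m → ℝ) (Z : Matrix m J ℝ) (lam τ : ℝ) (b : J → ℝ) : ℝ :=
  Real.log τ + cdTau n y Z b / τ + 2 * lam * ∑ j, |b j|

omit [Fintype m] in
theorem mulVec_update_eq (Z : Matrix m J ℝ) (b : J → ℝ) (j : J) (t : ℝ) (k : m) :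
    (Z *ᵥ Function.update b j t) k = (Z *ᵥ Function.update b j 0) k + Z k j * t := by
  have h : Function.update b j t = Function.update b j 0 + Pi.single j t := by
    funext l
    by_cases hl : l = j
    · subst hl; simp
    · simp [hl]
  rw [h, mulVec_add]
  simp [mulVec_single, mul_comm]

theorem sum_erase_mul_eq (Z : Matrix m J ℝ) (b : J → ℝ) (j : J) :
    ∑ l ∈ Finset.univ.erase j, (Zᵀ * Z) j l * b l =
      (Zᵀ *ᵥ (Z *ᵥ Function.update b j 0)) j := by
  rw [mulVec_mulVec, mulVec, dotProduct, ← Finset.add_sum_erase _ _ (Finset.mem_univ j)]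
  simp only [Function.update_self, mul_zero, zero_add]
  refine Finset.sum_congr rfl fun l hl => ?_
  rw [Function.update_of_ne (Finset.ne_of_mem_erase hl)]

theorem cdTau_update (n : ℕ) (y : m → ℝ) (Z : Matrix m J ℝ) (b : J → ℝ) (j : J) (t : ℝ) :
    cdTau n y Z (Function.update b j t) = cdTau n y Z (Function.update b j 0) +
      1 / (n : ℝ) * ((Zᵀ * Z) j j * t ^ 2 -
        2 * ((Zᵀ *ᵥ y) j - ∑ l ∈ Finset.univ.erase j, (Zᵀ * Z) j l * b l) * t) := by
  rw [sum_erase_mul_eq]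
  unfold cdTau
  simp only [mulVec_update_eq Z b j t]
  generalize Z *ᵥ Function.update b j 0 = w
  rw [← mul_add]
  congr 1
  simp only [mul_apply, mulVec, dotProduct, transpose_apply, Finset.sum_mul, Finset.mul_sum,
    ← Finset.sum_sub_distrib, ← Finset.sum_add_distrib]
  refine Finset.sum_congr rfl fun k _ => ?_
  ring

theorem cdObj_update (n : ℕ) (y : m → ℝ) (Z : Matrix m J ℝ) (lam τ : ℝ) (b : J → ℝ) (j : J)
    (t : ℝ) :
    cdObj n y Z lam τ (Function.update b j t) = cdObj n y Z lam τ (Function.update b j 0) +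
      ((1 / ((n : ℝ) * τ) * (Zᵀ * Z) j j) * t ^ 2 -
        2 * (1 / ((n : ℝ) * τ) *
          ((Zᵀ *ᵥ y) j - ∑ l ∈ Finset.univ.erase j, (Zᵀ * Z) j l * b l)) * t +
        2 * lam * |t|) := by
  have hs : ∀ u : ℝ, ∑ l, |Function.update b j u l| = |u| + ∑ l ∈ Finset.univ.erase j, |b l| := by
    intro u
    rw [← Finset.add_sum_erase _ _ (Finset.mem_univ j), Function.update_self]
    congr 1
    refine Finset.sum_congr rfl fun l hl => ?_
    rw [Function.update_of_ne (Finset.ne_of_mem_erase hl)]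
  unfold cdObj
  rw [hs t, hs 0, cdTau_update n y Z b j t, abs_zero]
  rw [one_div, one_div, mul_inv]
  ring

variable {n : ℕ} {y : m → ℝ} {Z : Matrix m J ℝ} {lam : ℝ}

/-- The quadratic surplus is the strong convexity of the one-dimensional problem; it turns "no
decrease" into "no move" in `cdCoord_eq_self_of_le`. -/
theorem cdObj_cdCoord_add_le (hn : 0 < n) (hlam : 0 ≤ lam) (hZ : ∀ j, 0 < (Zᵀ * Z) j j) {τ : ℝ}
    (hτ : 0 < τ) (b : J → ℝ) (j : J) (t : ℝ) :
    cdObj n y Z lam τ (cdCoord n y Z lam τ b j) +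
      (1 / ((n : ℝ) * τ) * (Zᵀ * Z) j j) * (t - cdCoord n y Z lam τ b j j) ^ 2 ≤
      cdObj n y Z lam τ (Function.update b j t) := by
  have hn' : (0 : ℝ) < n := by exact_mod_cast hn
  have hC : 0 < 1 / ((n : ℝ) * τ) * (Zᵀ * Z) j j := mul_pos (by positivity) (hZ j)
  have h := softThreshold_minimizes hlam hC (1 / ((n : ℝ) * τ) *
    ((Zᵀ *ᵥ y) j - ∑ l ∈ Finset.univ.erase j, (Zᵀ * Z) j l * b l)) t
  unfold cdCoord
  simp only [Function.update_self]
  rw [cdObj_update _ _ _ _ _ _ _ t, cdObj_update]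
  linarith

theorem cdObj_cdCoord_le (hn : 0 < n) (hlam : 0 ≤ lam) (hZ : ∀ j, 0 < (Zᵀ * Z) j j) {τ : ℝ}
    (hτ : 0 < τ) (b : J → ℝ) (j : J) (t : ℝ) :
    cdObj n y Z lam τ (cdCoord n y Z lam τ b j) ≤ cdObj n y Z lam τ (Function.update b j t) := by
  have h := cdObj_cdCoord_add_le (y := y) hn hlam hZ hτ b j t
  have h0 : 0 ≤ (1 / ((n : ℝ) * τ) * (Zᵀ * Z) j j) * (t - cdCoord n y Z lam τ b j j) ^ 2 :=
    mul_nonneg (mul_nonneg (by positivity) (hZ j).le) (sq_nonneg _)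
  linarith

theorem cdCoord_eq_self_of_le (hn : 0 < n) (hlam : 0 ≤ lam) (hZ : ∀ j, 0 < (Zᵀ * Z) j j) {τ : ℝ}
    (hτ : 0 < τ) (b : J → ℝ) (j : J)
    (h : cdObj n y Z lam τ b ≤ cdObj n y Z lam τ (cdCoord n y Z lam τ b j)) :
    cdCoord n y Z lam τ b j = b := by
  have hn' : (0 : ℝ) < n := by exact_mod_cast hn
  have h1 := cdObj_cdCoord_add_le (y := y) hn hlam hZ hτ b j (b j)
  rw [Function.update_eq_self] at h1
  have hC : 0 < 1 / ((n : ℝ) * τ) * (Zᵀ * Z) j j := mul_pos (by positivity) (hZ j)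
  have h2 : (b j - cdCoord n y Z lam τ b j j) ^ 2 = 0 := by
    by_contra hne
    have : 0 < (b j - cdCoord n y Z lam τ b j j) ^ 2 := lt_of_le_of_ne (sq_nonneg _) (Ne.symm hne)
    nlinarith [mul_pos hC this]
  have h3 : cdCoord n y Z lam τ b j j = b j := by
    have := pow_eq_zero_iff (two_ne_zero) |>.1 h2
    linarith
  funext l
  by_cases hl : l = j
  · subst hl; exact h3
  · simp [cdCoord, hl]

/-- If the composite does not decrease the objective, no single update does. The first one then
leaves `b` unchanged, so the remaining ones start from `b` again. -/
theorem cdObj_foldl_le (hn : 0 < n) (hlam : 0 ≤ lam) (hZ : ∀ j, 0 < (Zᵀ * Z) j j) {τ : ℝ}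
    (hτ : 0 < τ) (l : List J) (b : J → ℝ) :
    cdObj n y Z lam τ (l.foldl (cdCoord n y Z lam τ) b) ≤ cdObj n y Z lam τ b ∧
    (cdObj n y Z lam τ b ≤ cdObj n y Z lam τ (l.foldl (cdCoord n y Z lam τ) b) →
      l.foldl (cdCoord n y Z lam τ) b = b ∧ ∀ j ∈ l, cdCoord n y Z lam τ b j = b) := by
  induction l generalizing b with
  | nil => simp
  | cons j l ih =>
    obtain ⟨h1, h2⟩ := ih (cdCoord n y Z lam τ b j)
    have h3 := cdObj_cdCoord_le (y := y) hn hlam hZ hτ b j (b j)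
    rw [Function.update_eq_self] at h3
    refine ⟨h1.trans h3, fun h => ?_⟩
    simp only [List.foldl_cons] at h ⊢
    have h4 := cdCoord_eq_self_of_le hn hlam hZ hτ b j (h.trans h1)
    rw [h4] at h2 h ⊢
    obtain ⟨h5, h6⟩ := h2 h
    refine ⟨h5, ?_⟩
    intro k hk
    rcases List.mem_cons.1 hk with rfl | hk
    · exact h4
    · exact h6 k hk

omit [LinearOrder J] in
theorem cdTau_pos (hn : 0 < n) (hy : ∀ b, Z *ᵥ b ≠ y) (b : J → ℝ) : 0 < cdTau n y Z b := by
  have hn' : (0 : ℝ) < n := by exact_mod_cast hn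
  unfold cdTau
  refine mul_pos (by positivity) ?_
  refine lt_of_le_of_ne (Finset.sum_nonneg fun _ _ => sq_nonneg _) fun h => hy b ?_
  have h1 := (Finset.sum_eq_zero_iff_of_nonneg (fun _ _ => sq_nonneg _)).1 h.symm
  funext k
  have := pow_eq_zero_iff (two_ne_zero) |>.1 (h1 k (Finset.mem_univ k))
  linarith

omit [LinearOrder J] in
/-- The error variance `cdTau` is the unique minimizer of the objective for given coefficients. -/
theorem cdObj_cdTau_le (b : J → ℝ) (hq : 0 < cdTau n y Z b) {τ : ℝ} (hτ : 0 < τ) :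
    cdObj n y Z lam (cdTau n y Z b) b ≤ cdObj n y Z lam τ b ∧
    (cdObj n y Z lam τ b ≤ cdObj n y Z lam (cdTau n y Z b) b → τ = cdTau n y Z b) := by
  unfold cdObj
  set q := cdTau n y Z b
  rw [div_self hq.ne']
  have hlog : Real.log (q / τ) = Real.log q - Real.log τ := Real.log_div hq.ne' hτ.ne'
  constructor
  · have := Real.log_le_sub_one_of_pos (div_pos hq hτ)
    linarith
  · intro h
    by_contra hne
    have hne' : q / τ ≠ 1 := by
      intro h1
      rw [div_eq_one_iff_eq hτ.ne'] at h1
      exact hne h1.symm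
    have := Real.log_lt_sub_one_of_pos (div_pos hq hτ) hne'
    linarith

/-- `τ` is arbitrary because the variance encoded in the matrix before a pass need not be the
residual variance of its coefficients; passing to `cdTau` is itself a minimization step. -/
theorem cdObj_cdPass_le (hn : 0 < n) (hlam : 0 ≤ lam) (hZ : ∀ j, 0 < (Zᵀ * Z) j j)
    (hy : ∀ b, Z *ᵥ b ≠ y) {τ : ℝ} (hτ : 0 < τ) (b : J → ℝ) :
    cdObj n y Z lam (cdTau n y Z b) (cdPass n y Z lam b) ≤ cdObj n y Z lam τ b ∧
    (cdObj n y Z lam τ b ≤ cdObj n y Z lam (cdTau n y Z b) (cdPass n y Z lam b) →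
      τ = cdTau n y Z b ∧ cdPass n y Z lam b = b ∧
        ∀ j, cdCoord n y Z lam (cdTau n y Z b) b j = b) := by
  have hq := cdTau_pos hn hy b
  obtain ⟨h1, h2⟩ := cdObj_cdTau_le (lam := lam) b hq hτ
  obtain ⟨h3, h4⟩ := cdObj_foldl_le (y := y) hn hlam hZ hq
    ((Finset.univ : Finset J).sort (· ≤ ·)) b
  refine ⟨h3.trans h1, fun h => ?_⟩
  obtain ⟨h5, h6⟩ := h4 (h1.trans h)
  exact ⟨h2 (h.trans h3), h5, fun j => h6 j (by simp)⟩

theorem cdCoord_eq_self_of_cdPass_eq_self (hn : 0 < n) (hlam : 0 ≤ lam)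
    (hZ : ∀ j, 0 < (Zᵀ * Z) j j) (hy : ∀ b, Z *ᵥ b ≠ y) {b : J → ℝ}
    (hb : cdPass n y Z lam b = b) (j : J) : cdCoord n y Z lam (cdTau n y Z b) b j = b :=
  ((cdObj_cdPass_le hn hlam hZ hy (cdTau_pos hn hy b) b).2 (by rw [hb])).2.2 j

/-- The normal equations satisfied by a fixed coordinate. -/
theorem cdCoord_normal_equation (hn : 0 < n) (hlam : 0 ≤ lam) (hZ : ∀ j, 0 < (Zᵀ * Z) j j) {τ : ℝ}
    (hτ : 0 < τ) {b : J → ℝ} {j : J} (h : cdCoord n y Z lam τ b j = b) (hbj : b j ≠ 0) :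
    (Zᵀ *ᵥ (y - Z *ᵥ b)) j = (n * lam * SignType.sign (b j)) * τ := by
  have hn' : (0 : ℝ) < n := by exact_mod_cast hn
  have hC : 0 < 1 / ((n : ℝ) * τ) * (Zᵀ * Z) j j := mul_pos (by positivity) (hZ j)
  obtain ⟨-, h2⟩ := softThreshold_optimality hlam hC (1 / ((n : ℝ) * τ) *
    ((Zᵀ *ᵥ y) j - ∑ l ∈ Finset.univ.erase j, (Zᵀ * Z) j l * b l))
  have hval := congrFun h j
  simp only [cdCoord, Function.update_self] at hval
  rw [hval] at h2
  have hsum : (Zᵀ *ᵥ (Z *ᵥ b)) j = (Zᵀ * Z) j j * b j +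
      ∑ l ∈ Finset.univ.erase j, (Zᵀ * Z) j l * b l := by
    rw [mulVec_mulVec, mulVec, dotProduct, ← Finset.add_sum_erase _ _ (Finset.mem_univ j)]
  rw [mulVec_sub, Pi.sub_apply, hsum]
  have habs : |b j| = SignType.sign (b j) * b j := (sign_mul_self (b j)).symm
  rw [habs] at h2
  have h3 := mul_right_cancel₀ hbj (h2.trans (mul_assoc _ _ _).symm)
  field_simp at h3
  linarith

/-- Sort the fixed points by sign pattern. On one pattern the normal equations are affine in `b`
with the variance `τ` as a parameter, and `Z` is injective, so two distinct solutions span a line `u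
+ τ v` containing all others. On it, `‖y - Z(u + τ v)‖² = n τ` is a polynomial equation in `τ`,
nontrivial because the left side is positive at `τ = 0`. -/
theorem finite_setOf_cdPass_eq_self (hn : 0 < n) (hlam : 0 ≤ lam)
    (hinj : ∀ b, Z *ᵥ b = 0 → b = 0) (hZ : ∀ j, 0 < (Zᵀ * Z) j j) (hy : ∀ b, Z *ᵥ b ≠ y) :
    {b | cdPass n y Z lam b = b}.Finite := by
  have hn' : (0 : ℝ) < n := by exact_mod_cast hn
  -- Pairing with `d` gives `‖Z d‖² = 0`, since only coordinates in the support of `d` contribute.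
  have key : ∀ (d : J → ℝ), (∀ j, d j ≠ 0 → (Zᵀ *ᵥ (Z *ᵥ d)) j = 0) → d = 0 := by
    intro d hd
    apply hinj
    have h1 : (Z *ᵥ d) ⬝ᵥ (Z *ᵥ d) = 0 := by
      rw [dotProduct_mulVec, ← mulVec_transpose]
      refine Finset.sum_eq_zero fun j _ => ?_
      by_cases h : d j = 0
      · simp [h]
      · simp [hd j h]
    exact dotProduct_self_eq_zero.1 h1
  have hcover : {b | cdPass n y Z lam b = b} ⊆ ⋃ s : J → SignType,
      {b | cdPass n y Z lam b = b ∧ ∀ j, SignType.sign (b j) = s j} := by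
    intro b hb
    exact Set.mem_iUnion.2 ⟨fun j => SignType.sign (b j), hb, fun _ => rfl⟩
  refine (Set.finite_iUnion fun s => ?_).subset hcover
  set V := {b | cdPass n y Z lam b = b ∧ ∀ j, SignType.sign (b j) = s j} with hV
  have hns : ∀ b ∈ V, ∀ j, s j ≠ 0 →
      (Zᵀ *ᵥ (y - Z *ᵥ b)) j = (n * lam * s j) * cdTau n y Z b := by
    intro b hb j hj
    have h := cdCoord_normal_equation (y := y) hn hlam hZ (cdTau_pos hn hy b)
      (cdCoord_eq_self_of_cdPass_eq_self hn hlam hZ hy hb.1 j)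
      (fun h0 => hj (by rw [← hb.2 j, h0, sign_zero]))
    rw [h, hb.2 j]
  have hz : ∀ b ∈ V, ∀ j, s j = 0 → b j = 0 := by
    intro b hb j hj
    rw [← sign_eq_zero_iff, hb.2 j, hj]
  by_cases hsub : V.Subsingleton
  · exact hsub.finite
  obtain ⟨b₁, hb₁, b₂, hb₂, hne⟩ := Set.not_subsingleton_iff.1 hsub
  have hdiff : ∀ b ∈ V, ∀ b' ∈ V, ∀ j, s j ≠ 0 →
      (Zᵀ *ᵥ (Z *ᵥ (b - b'))) j = (n * lam * s j) * (cdTau n y Z b' - cdTau n y Z b) := by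
    intro b hb b' hb' j hj
    have h1 := hns b hb j hj
    have h2 := hns b' hb' j hj
    have : Z *ᵥ (b - b') = (y - Z *ᵥ b') - (y - Z *ᵥ b) := by rw [mulVec_sub]; abel
    rw [this, mulVec_sub, Pi.sub_apply, h1, h2]
    ring
  set τ₁ := cdTau n y Z b₁ with hτ₁
  set τ₂ := cdTau n y Z b₂ with hτ₂
  -- Equal variances would give equal right-hand sides in the normal equations, hence equal points;
  -- so `τ` can parametrize the line through the two points.
  have hτne : τ₂ - τ₁ ≠ 0 := by
    intro h0
    apply hne
    have h3 : b₁ - b₂ = 0 := by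
      apply key
      intro j hj
      have hsj : s j ≠ 0 := by
        intro hs
        apply hj
        simp [hz b₁ hb₁ j hs, hz b₂ hb₂ j hs]
      rw [hdiff b₁ hb₁ b₂ hb₂ j hsj, ← hτ₁, ← hτ₂, h0, mul_zero]
    exact sub_eq_zero.1 h3
  set v := (τ₂ - τ₁)⁻¹ • (b₂ - b₁) with hv
  set u := b₁ - τ₁ • v with hu
  have hline : ∀ b ∈ V, b = u + cdTau n y Z b • v := by
    intro b hb
    have h3 : b - (u + cdTau n y Z b • v) = 0 := by
      apply key
      intro j hj
      have hsj : s j ≠ 0 := by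
        intro hs
        apply hj
        simp [hu, hv, hz b₁ hb₁ j hs, hz b₂ hb₂ j hs, hz b hb j hs]
      have h4 : b - (u + cdTau n y Z b • v) =
          (b - b₁) - ((cdTau n y Z b - τ₁) * (τ₂ - τ₁)⁻¹) • (b₂ - b₁) := by
        rw [hu, hv]; module
      rw [h4, mulVec_sub, mulVec_sub, mulVec_smul, mulVec_smul, Pi.sub_apply, Pi.smul_apply,
        hdiff b hb b₁ hb₁ j hsj, hdiff b₂ hb₂ b₁ hb₁ j hsj, ← hτ₁, ← hτ₂, smul_eq_mul]
      field_simp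
      ring
    exact sub_eq_zero.1 h3
  set P : Polynomial ℝ := (∑ k, (Polynomial.C ((y - Z *ᵥ u) k) -
    Polynomial.C ((Z *ᵥ v) k) * Polynomial.X) ^ 2) - Polynomial.C (n : ℝ) * Polynomial.X with hP
  have hPeval : ∀ t, P.eval t = (∑ k, (y k - (Z *ᵥ (u + t • v)) k) ^ 2) - n * t := by
    intro t
    rw [hP, Polynomial.eval_sub, Polynomial.eval_finsetSum]
    simp only [Polynomial.eval_pow, Polynomial.eval_sub, Polynomial.eval_mul, Polynomial.eval_C,
      Polynomial.eval_X, mulVec_add, mulVec_smul, Pi.add_apply, Pi.smul_apply, Pi.sub_apply,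
      smul_eq_mul]
    congr 1
    refine Finset.sum_congr rfl fun k _ => ?_
    ring
  have hsq : ∀ b, ∑ k, (y k - (Z *ᵥ b) k) ^ 2 = n * cdTau n y Z b := by
    intro b
    unfold cdTau
    field_simp
  have hP0 : P ≠ 0 := by
    intro h0
    have h5 := hPeval 0
    rw [h0, Polynomial.eval_zero, hsq, zero_smul, add_zero] at h5
    have := mul_pos hn' (cdTau_pos hn hy u)
    linarith
  refine ((Polynomial.finite_setOfPred_isRoot hP0).image fun t => u + t • v).subset ?_
  intro b hb
  refine ⟨cdTau n y Z b, ?_, (hline b hb).symm⟩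
  change P.eval _ = 0
  rw [hPeval, ← hline b hb, hsq, sub_self]

omit [LinearOrder J] in
theorem tendsto_cdTau {ι : Type*} {l : Filter ι} {Zs : ι → Matrix m J ℝ} {bs : ι → J → ℝ}
    {b : J → ℝ} (hZs : Tendsto Zs l (𝓝 Z)) (hbs : Tendsto bs l (𝓝 b)) :
    Tendsto (fun x => cdTau n y (Zs x) (bs x)) l (𝓝 (cdTau n y Z b)) := by
  have h1 : Tendsto (fun x => Zs x *ᵥ bs x) l (𝓝 (Z *ᵥ b)) := by
    have hc : Continuous fun q : Matrix m J ℝ × (J → ℝ) => q.1 *ᵥ q.2 :=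
      continuous_fst.matrix_mulVec continuous_snd
    exact (hc.tendsto (Z, b)).comp (hZs.prodMk_nhds hbs)
  refine Tendsto.const_mul _ (tendsto_finsetSum _ fun k _ => ?_)
  exact (tendsto_const_nhds.sub (tendsto_pi_nhds.1 h1 k)).pow 2

/-- The predictors vary too, since they depend on the block outside row and column `i`. Positivity
of `τ` and of the Gram diagonal at the limit keeps the divisions continuous. -/
theorem tendsto_cdCoord_foldl (hn : 0 < n) (hlam : 0 ≤ lam) (hZ : ∀ j, 0 < (Zᵀ * Z) j j)
    {ι : Type*} {l : Filter ι} {Zs : ι → Matrix m J ℝ} {τs : ι → ℝ} {τ : ℝ} (hτ : 0 < τ)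
    (hZs : Tendsto Zs l (𝓝 Z)) (hτs : Tendsto τs l (𝓝 τ)) (L : List J) {bs : ι → J → ℝ}
    {b : J → ℝ} (hbs : Tendsto bs l (𝓝 b)) :
    Tendsto (fun x => L.foldl (cdCoord n y (Zs x) lam (τs x)) (bs x)) l
      (𝓝 (L.foldl (cdCoord n y Z lam τ) b)) := by
  have hn' : (0 : ℝ) < n := by exact_mod_cast hn
  induction L generalizing bs b with
  | nil => exact hbs
  | cons j L ih =>
    apply ih
    have hG : Tendsto (fun x => (Zs x)ᵀ * Zs x) l (𝓝 (Zᵀ * Z)) := by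
      have hc : Continuous fun W : Matrix m J ℝ => Wᵀ * W := by fun_prop
      exact (hc.tendsto Z).comp hZs
    have hGe : ∀ k, Tendsto (fun x => ((Zs x)ᵀ * Zs x) j k) l (𝓝 ((Zᵀ * Z) j k)) := fun k =>
      tendsto_pi_nhds.1 (tendsto_pi_nhds.1 hG j) k
    have hbe : ∀ k, Tendsto (fun x => bs x k) l (𝓝 (b k)) := tendsto_pi_nhds.1 hbs
    have hv : Tendsto (fun x => ((Zs x)ᵀ *ᵥ y) j) l (𝓝 ((Zᵀ *ᵥ y) j)) := by
      have hc : Continuous fun W : Matrix m J ℝ => (Wᵀ *ᵥ y) j := by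
        unfold mulVec dotProduct; simp only [transpose_apply]; fun_prop
      exact (hc.tendsto Z).comp hZs
    have hnτ : Tendsto (fun x => 1 / ((n : ℝ) * τs x)) l (𝓝 (1 / ((n : ℝ) * τ))) :=
      tendsto_const_nhds.div (tendsto_const_nhds.mul hτs) (by positivity)
    have hC : (1 / ((n : ℝ) * τ) * (Zᵀ * Z) j j) ≠ 0 :=
      (mul_pos (by positivity) (hZ j)).ne'
    refine tendsto_pi_nhds.2 fun k => ?_
    by_cases hk : k = j
    · subst hk
      simp only [cdCoord, Function.update_self]
      refine (tendsto_const_nhds.div (hnτ.mul (hGe k)) hC).mul ?_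
      refine ((continuous_softThreshold hlam).tendsto _).comp (hnτ.mul (hv.sub ?_))
      exact tendsto_finsetSum _ fun i _ => (hGe i).mul (hbe i)
    · simpa [cdCoord, hk] using hbe k

theorem tendsto_cdPass (hn : 0 < n) (hlam : 0 ≤ lam) (hZ : ∀ j, 0 < (Zᵀ * Z) j j)
    (hy : ∀ b, Z *ᵥ b ≠ y) {ι : Type*} {l : Filter ι} {Zs : ι → Matrix m J ℝ} {bs : ι → J → ℝ}
    {b : J → ℝ} (hZs : Tendsto Zs l (𝓝 Z)) (hbs : Tendsto bs l (𝓝 b)) :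
    Tendsto (fun x => cdPass n y (Zs x) lam (bs x)) l (𝓝 (cdPass n y Z lam b)) :=
  tendsto_cdCoord_foldl hn hlam hZ (cdTau_pos hn hy b) hZs (tendsto_cdTau hZs hbs) _ hbs

end

/-! ### Replacing one row and column of a positive definite matrix -/

/-- Splitting off one index. -/
def splitIdx {p : ℕ} (i : Fin p) : Fin p ≃ {j : Fin p // j ≠ i} ⊕ Unit where
  toFun a := if h : a ≠ i then Sum.inl ⟨a, h⟩ else Sum.inr ()
  invFun := Sum.elim Subtype.val fun _ => i
  left_inv a := by by_cases h : a = i <;> simp [h]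
  right_inv x := by
    rcases x with ⟨a, h⟩ | _
    · simp [h]
    · simp

/-- The conditional variance of the variable `i` given the others. -/
def residVar {p : ℕ} (A : Matrix (Fin p) (Fin p) ℝ) (i : Fin p) : ℝ :=
  A i i - (fun j : {j : Fin p // j ≠ i} => A j.1 i) ⬝ᵥ
    ((dropIdx A i)⁻¹ *ᵥ fun j : {j : Fin p // j ≠ i} => A j.1 i)

section

variable {p : ℕ} {A : Matrix (Fin p) (Fin p) ℝ} {i : Fin p}

theorem replaceIdx_self (τ : ℝ) (s : {j : Fin p // j ≠ i} → ℝ) :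
    replaceIdx A i τ s i i = τ + s ⬝ᵥ ((dropIdx A i)⁻¹ *ᵥ s) := by
  simp [replaceIdx]

theorem replaceIdx_left (τ : ℝ) (s : {j : Fin p // j ≠ i} → ℝ) (b : {j : Fin p // j ≠ i}) :
    replaceIdx A i τ s i b.1 = s b := by
  simp [replaceIdx, b.2]

theorem replaceIdx_right (τ : ℝ) (s : {j : Fin p // j ≠ i} → ℝ) (a : {j : Fin p // j ≠ i}) :
    replaceIdx A i τ s a.1 i = s a := by
  simp [replaceIdx, a.2]

theorem replaceIdx_of_ne (τ : ℝ) (s : {j : Fin p // j ≠ i} → ℝ) {a b : Fin p} (ha : a ≠ i)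
    (hb : b ≠ i) : replaceIdx A i τ s a b = A a b := by
  simp [replaceIdx, ha, hb]

theorem dropIdx_replaceIdx (τ : ℝ) (s : {j : Fin p // j ≠ i} → ℝ) :
    dropIdx (replaceIdx A i τ s) i = dropIdx A i := by
  ext a b
  exact replaceIdx_of_ne τ s a.2 b.2

theorem replaceIdx_congr {B : Matrix (Fin p) (Fin p) ℝ} (h : dropIdx A i = dropIdx B i) (τ : ℝ)
    (s : {j : Fin p // j ≠ i} → ℝ) : replaceIdx A i τ s = replaceIdx B i τ s := by
  ext a b
  by_cases ha : a = i
  · by_cases hb : b = i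
    · simp [replaceIdx, ha, hb, h]
    · simp [replaceIdx, ha, hb]
  · by_cases hb : b = i
    · simp [replaceIdx, ha, hb]
    · simp only [replaceIdx, of_apply, ha, hb, dite_false, if_false]
      exact congrFun (congrFun h ⟨a, ha⟩) ⟨b, hb⟩

theorem dropIdx_posDef (hA : A.PosDef) (i : Fin p) : (dropIdx A i).PosDef :=
  hA.submatrix Subtype.val_injective

theorem replaceIdx_residVar (hA : A.IsHermitian) (i : Fin p) :
    replaceIdx A i (residVar A i) (fun j => A j.1 i) = A := by
  ext a b
  by_cases ha : a = i
  · by_cases hb : b = i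
    · subst ha; subst hb
      rw [replaceIdx_self, residVar]; ring
    · subst ha
      rw [replaceIdx_left _ _ ⟨b, hb⟩]
      have := hA.apply a b
      simpa using this
  · by_cases hb : b = i
    · subst hb
      rw [replaceIdx_right _ _ ⟨a, ha⟩]
    · rw [replaceIdx_of_ne _ _ ha hb]

theorem replaceIdx_eq_submatrix (τ : ℝ) (s : {j : Fin p // j ≠ i} → ℝ) :
    replaceIdx A i τ s = (fromBlocks (dropIdx A i) (replicateCol Unit s) (replicateCol Unit s)ᴴ
      (of fun _ _ => τ + s ⬝ᵥ ((dropIdx A i)⁻¹ *ᵥ s))).submatrix (splitIdx i) (splitIdx i) := by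
  ext a b
  by_cases ha : a = i <;> by_cases hb : b = i <;>
    simp [replaceIdx, splitIdx, ha, hb, dropIdx]

/-- The new diagonal entry is designed to make the Schur complement equal to `τ`. -/
theorem schur_replaceIdx (τ : ℝ) (s : {j : Fin p // j ≠ i} → ℝ) :
    (of fun _ _ => τ + s ⬝ᵥ ((dropIdx A i)⁻¹ *ᵥ s) : Matrix Unit Unit ℝ) -
      (replicateCol Unit s)ᴴ * (dropIdx A i)⁻¹ * replicateCol Unit s = of fun _ _ => τ := by
  ext a b
  rw [Matrix.mul_assoc]
  have : ((replicateCol Unit s)ᴴ * ((dropIdx A i)⁻¹ * replicateCol Unit s)) a b =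
      s ⬝ᵥ ((dropIdx A i)⁻¹ *ᵥ s) := by
    simp [mul_apply, dotProduct, mulVec]
  rw [Matrix.sub_apply, this, of_apply, of_apply]
  ring

theorem det_replaceIdx (hM : (dropIdx A i).PosDef) (τ : ℝ) (s : {j : Fin p // j ≠ i} → ℝ) :
    (replaceIdx A i τ s).det = (dropIdx A i).det * τ := by
  have : Invertible (dropIdx A i) := hM.isUnit.invertible
  rw [replaceIdx_eq_submatrix, det_submatrix_equiv_self, det_fromBlocks₁₁, invOf_eq_nonsing_inv,
    schur_replaceIdx, det_unique (n := Unit), of_apply]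

theorem replaceIdx_posDef (hM : (dropIdx A i).PosDef) {τ : ℝ} (hτ : 0 < τ)
    (s : {j : Fin p // j ≠ i} → ℝ) : (replaceIdx A i τ s).PosDef := by
  have : Invertible (dropIdx A i) := hM.isUnit.invertible
  have hps : (replaceIdx A i τ s).PosSemidef := by
    rw [replaceIdx_eq_submatrix]
    refine PosSemidef.submatrix ?_ _
    rw [PosDef.fromBlocks₁₁ _ _ hM, schur_replaceIdx]
    have h1 : (of fun _ _ => τ : Matrix Unit Unit ℝ) = diagonal fun _ => τ := by
      ext a b; simp [diagonal]
    rw [h1]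
    exact PosSemidef.diagonal fun _ => hτ.le
  rw [hps.posDef_iff_det_ne_zero, det_replaceIdx hM]
  exact (mul_pos hM.det_pos hτ).ne'

/-- By the determinant formula this is a quotient of two positive determinants. -/
theorem residVar_pos (hA : A.PosDef) (i : Fin p) : 0 < residVar A i := by
  have h := det_replaceIdx (dropIdx_posDef hA i) (residVar A i) (fun j => A j.1 i)
  rw [replaceIdx_residVar hA.1] at h
  have h1 := hA.det_pos
  rw [h] at h1
  exact pos_of_mul_pos_right h1 (dropIdx_posDef hA i).det_pos.le

/-- The vector of coefficients of the regression of the variable `i` on the others, with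
residual `y_i - ∑ j ≠ i, (M⁻¹ s)_j y_j`. -/
def residVec (i : Fin p) (w : {j : Fin p // j ≠ i} → ℝ) : Fin p → ℝ :=
  fun a => if h : a ≠ i then -w ⟨a, h⟩ else 1

/-- A matrix on `V \ {i}`, filled with zeros to a matrix on `V`. -/
def padIdx (i : Fin p) (M : Matrix {j : Fin p // j ≠ i} {j : Fin p // j ≠ i} ℝ) :
    Matrix (Fin p) (Fin p) ℝ :=
  of fun a b => if h : a ≠ i ∧ b ≠ i then M ⟨a, h.1⟩ ⟨b, h.2⟩ else 0

/-- The matrix sends the residual vector `v`, with entry `1` at `i` and `-M⁻¹ s` elsewhere, to `τ`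
times the `i`-th unit vector; a rank-one term in `v` therefore corrects the padded inverse of the
block. In this form the trace term of the objective becomes a residual sum of squares over `τ`. -/
theorem inv_replaceIdx (hM : (dropIdx A i).PosDef) {τ : ℝ} (hτ : 0 < τ)
    (s : {j : Fin p // j ≠ i} → ℝ) :
    (replaceIdx A i τ s)⁻¹ = padIdx i (dropIdx A i)⁻¹ +
      (1 / τ) • vecMulVec (residVec i ((dropIdx A i)⁻¹ *ᵥ s))
        (residVec i ((dropIdx A i)⁻¹ *ᵥ s)) := by
  have hu : IsUnit (dropIdx A i).det := hM.det_pos.ne'.isUnit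
  set M := dropIdx A i with hMdef
  have hMsymm : ∀ a b, M⁻¹ a b = M⁻¹ b a := fun a b => by
    have := hM.inv.1.apply a b
    simpa using this.symm
  set w := M⁻¹ *ᵥ s with hw
  have hMw : M *ᵥ w = s := by
    rw [hw, mulVec_mulVec, mul_nonsing_inv _ hu, one_mulVec]
  have hRv : ∀ a, (replaceIdx A i τ s *ᵥ residVec i w) a = if a = i then τ else 0 := by
    intro a
    rw [mulVec, dotProduct, Fintype.sum_eq_add_sum_subtype_ne _ i]
    by_cases ha : a = i
    · subst ha
      rw [replaceIdx_self]
      have : ∀ j : {j : Fin p // j ≠ a}, replaceIdx A a τ s a j.1 * residVec a w j.1 =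
          -(s j * w j) := by
        intro j
        rw [replaceIdx_left]; simp [residVec, j.2]
      simp only [this, Finset.sum_neg_distrib]
      simp [residVec, dotProduct, ← hMdef, ← hw]
    · have : ∀ j : {j : Fin p // j ≠ i}, replaceIdx A i τ s a j.1 * residVec i w j.1 =
          -(M ⟨a, ha⟩ j * w j) := by
        intro j
        rw [replaceIdx_of_ne _ _ ha j.2]; simp [residVec, j.2, hMdef, dropIdx]
      simp only [this, Finset.sum_neg_distrib]
      rw [replaceIdx_right _ _ ⟨a, ha⟩, ← hMw]
      simp [residVec, mulVec, dotProduct, ha]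
  refine inv_eq_right_inv ?_
  rw [Matrix.mul_add, Matrix.mul_smul, mul_vecMulVec]
  ext a b
  rw [Matrix.add_apply, Matrix.smul_apply, vecMulVec_apply, hRv, mul_apply,
    Fintype.sum_eq_add_sum_subtype_ne _ i]
  have hi : padIdx i M⁻¹ i b = 0 := by simp [padIdx]
  rw [hi, mul_zero, zero_add, smul_eq_mul]
  by_cases hb : b = i
  · subst hb
    have : ∀ j, padIdx b M⁻¹ j b = 0 := by simp [padIdx]
    simp only [this, mul_zero, Finset.sum_const_zero, zero_add]
    by_cases ha : a = b
    · subst ha; simp [residVec, hτ.ne']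
    · simp [ha]
  · have hP : ∀ j : {j : Fin p // j ≠ i}, padIdx i M⁻¹ j.1 b = M⁻¹ j ⟨b, hb⟩ := by
      intro j; simp [padIdx, j.2, hb]
    simp only [hP]
    by_cases ha : a = i
    · subst ha
      simp only [replaceIdx_left, if_true]
      have : ∑ j, s j * M⁻¹ j ⟨b, hb⟩ = w ⟨b, hb⟩ := by
        rw [hw, mulVec, dotProduct]
        exact Finset.sum_congr rfl fun j _ => by rw [hMsymm, mul_comm]
      rw [this]
      simp only [residVec, ne_eq, hb, not_false_eq_true, dite_true]
      rw [one_apply_ne (Ne.symm hb)]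
      field_simp
      ring
    · have hmm : ∑ j : {j : Fin p // j ≠ i}, replaceIdx A i τ s a j.1 * M⁻¹ j ⟨b, hb⟩ =
          (M * M⁻¹) ⟨a, ha⟩ ⟨b, hb⟩ := by
        rw [mul_apply]
        exact Finset.sum_congr rfl fun j _ => by rw [replaceIdx_of_ne _ _ ha j.2]; rfl
      rw [hmm, mul_nonsing_inv _ hu]
      simp [ha, one_apply]

theorem sum_abs_replaceIdx (τ : ℝ) (s : {j : Fin p // j ≠ i} → ℝ) :
    (∑ j, ∑ k, if j ≠ k then |replaceIdx A i τ s j k| else 0) =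
      (∑ j, ∑ k, if j ≠ k then |dropIdx A i j k| else 0) + 2 * ∑ j, |s j| := by
  have h1 : ∀ j : Fin p, (∑ k, if j ≠ k then |replaceIdx A i τ s j k| else 0) =
      (if j ≠ i then |replaceIdx A i τ s j i| else 0) +
        ∑ k : {j : Fin p // j ≠ i}, if j ≠ k then |replaceIdx A i τ s j k| else 0 := fun j =>
    Fintype.sum_eq_add_sum_subtype_ne _ i
  rw [Fintype.sum_eq_add_sum_subtype_ne _ i, h1 i]
  have h2 : ∀ j : {j : Fin p // j ≠ i}, (∑ k, if j.1 ≠ k then |replaceIdx A i τ s j.1 k| else 0) =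
      |s j| + ∑ k, if j ≠ k then |dropIdx A i j k| else 0 := by
    intro j
    rw [h1 j.1, if_pos j.2, replaceIdx_right]
    congr 1
    refine Finset.sum_congr rfl fun k _ => ?_
    rw [replaceIdx_of_ne _ _ j.2 k.2]
    simp [dropIdx, Subtype.ext_iff]
  simp only [h2, Finset.sum_add_distrib]
  have h3 : (∑ k : {j : Fin p // j ≠ i}, if i ≠ k.1 then |replaceIdx A i τ s i k.1| else 0) =
      ∑ k, |s k| := by
    refine Finset.sum_congr rfl fun k _ => ?_
    rw [if_pos (Ne.symm k.2), replaceIdx_left]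
  rw [h3]
  simp
  ring

end

/-! ### The objective function -/

section

variable {n p : ℕ} (Y : Matrix (Fin n) (Fin p) ℝ) {lam κ : ℝ}

theorem penObjective_eq (lam κ : ℝ) (A : Matrix (Fin p) (Fin p) ℝ) :
    penObjective Y lam κ A = -Real.log A.det - (A⁻¹ * ridgeCov Y κ).trace -
      lam * ∑ j, ∑ k, if j ≠ k then |A j k| else 0 := by
  unfold penObjective gaussLogLik ridgeLassoPenalty ridgeCov
  rw [Matrix.mul_add, trace_add, Matrix.mul_smul, trace_smul, Matrix.mul_one, smul_eq_mul]
  simp only [trace, diag_apply]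
  ring

/-- The appended rows contribute `n κ I`, so the ridge penalty amounts to additional observations.
-/
theorem extData_gram (hn : 0 < n) (hκ : 0 ≤ κ) :
    (extData Y κ)ᵀ * extData Y κ = (n : ℝ) • ridgeCov Y κ := by
  have hn' : (0 : ℝ) < n := by exact_mod_cast hn
  unfold extData ridgeCov sampleCov
  rw [transpose_fromRows, fromCols_mul_fromRows, transpose_smul, transpose_one, smul_add, smul_smul,
    smul_smul, mul_one_div_cancel hn'.ne', one_smul, Matrix.smul_mul, Matrix.mul_smul, smul_smul,
    Real.mul_self_sqrt (by positivity), Matrix.one_mul]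

theorem dotProduct_ridgeCov (hn : 0 < n) (hκ : 0 ≤ κ) (v : Fin p → ℝ) :
    v ⬝ᵥ (ridgeCov Y κ *ᵥ v) = 1 / (n : ℝ) * ∑ k, ((extData Y κ *ᵥ v) k) ^ 2 := by
  have hn' : (0 : ℝ) < n := by exact_mod_cast hn
  have h : ∑ k, ((extData Y κ *ᵥ v) k) ^ 2 = (extData Y κ *ᵥ v) ⬝ᵥ (extData Y κ *ᵥ v) := by
    simp [dotProduct, sq]
  rw [h, dotProduct_mulVec (extData Y κ *ᵥ v), ← mulVec_transpose, mulVec_mulVec, extData_gram Y hn hκ, smul_mulVec,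
    smul_dotProduct, dotProduct_comm, smul_eq_mul]
  field_simp

theorem extData_mulVec_injective (hn : 0 < n) (hκ : 0 ≤ κ) (hS : (ridgeCov Y κ).PosDef)
    {v : Fin p → ℝ} (hv : extData Y κ *ᵥ v = 0) : v = 0 := by
  by_contra hne
  have h1 := hS.dotProduct_mulVec_pos hne
  rw [star_trivial, dotProduct_ridgeCov Y hn hκ, hv] at h1
  simp at h1

variable (G : SimpleGraph (Fin p)) [DecidableRel G.Adj] {A : Matrix (Fin p) (Fin p) ℝ} {i : Fin p}

theorem Bd.extend_incl (b : Bd G i → ℝ) (j : Bd G i) : Bd.extend G i b (Bd.incl G i j) = b j := by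
  simp [Bd.extend, Bd.incl, j.2]

theorem Bd.extend_of_notMem (b : Bd G i → ℝ) (j : {j : Fin p // j ≠ i})
    (hj : j ∉ Set.range (Bd.incl G i)) : Bd.extend G i b j = 0 := by
  unfold Bd.extend
  rw [dif_neg]
  intro h
  exact hj ⟨⟨j.1, h⟩, rfl⟩

omit [DecidableRel G.Adj] in
theorem Bd.incl_injective : Function.Injective (Bd.incl G i) := fun a b h => by
  simpa [Bd.incl, Subtype.ext_iff] using h

theorem Bd.sum_extend (b : Bd G i → ℝ) (f : {j : Fin p // j ≠ i} → ℝ → ℝ) (hf : ∀ j, f j 0 = 0) :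
    ∑ j, f j (Bd.extend G i b j) = ∑ j : Bd G i, f (Bd.incl G i j) (b j) := by
  symm
  refine Fintype.sum_of_injective (Bd.incl G i) (Bd.incl_injective G) _ _ ?_ ?_
  · intro j hj
    rw [Bd.extend_of_notMem G b j hj, hf]
  · intro j
    rw [Bd.extend_incl]

/-- Regressing on the pseudo-predictors with coefficients `b` is regressing on all other variables
with coefficients `Σ_{-i,-i}⁻¹ s`, where `s` is `b` padded by zeros. The zero pattern of `Σ` thus
turns into the omission of columns. -/
theorem pseudoPred_mulVec (b : Bd G i → ℝ) :
    pseudoPred Y κ G A i *ᵥ b = (extData Y κ).submatrix id (Subtype.val : {j // j ≠ i} → Fin p) *ᵥ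
      ((dropIdx A i)⁻¹ *ᵥ Bd.extend G i b) := by
  rw [mulVec_mulVec]
  funext k
  exact (Bd.sum_extend G b (fun j x => ((extData Y κ).submatrix id
    (Subtype.val : {j // j ≠ i} → Fin p) * (dropIdx A i)⁻¹) k j * x) (by simp)).symm

theorem extData_mulVec_residVec (w : {j : Fin p // j ≠ i} → ℝ) (k : Fin n ⊕ Fin p) :
    (extData Y κ *ᵥ residVec i w) k = extData Y κ k i -
      ((extData Y κ).submatrix id (Subtype.val : {j // j ≠ i} → Fin p) *ᵥ w) k := by
  rw [mulVec, dotProduct, Fintype.sum_eq_add_sum_subtype_ne _ i, sub_eq_add_neg]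
  congr 1
  · simp [residVec]
  · rw [mulVec, dotProduct, ← Finset.sum_neg_distrib]
    refine Finset.sum_congr rfl fun j _ => ?_
    simp [residVec, j.2]

/-- A perfect fit would put a vector with `i`-th entry `1` into the kernel of the extended data
matrix. This is what keeps `τ` positive. -/
theorem pseudoPred_mulVec_ne (hn : 0 < n) (hκ : 0 ≤ κ) (hS : (ridgeCov Y κ).PosDef)
    (b : Bd G i → ℝ) : pseudoPred Y κ G A i *ᵥ b ≠ fun k => extData Y κ k i := by
  intro h
  have h1 : extData Y κ *ᵥ residVec i ((dropIdx A i)⁻¹ *ᵥ Bd.extend G i b) = 0 := by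
    funext k
    rw [extData_mulVec_residVec, ← pseudoPred_mulVec, h]
    simp
  have h2 := congrFun (extData_mulVec_injective Y hn hκ hS h1) i
  simp [residVec] at h2

theorem pseudoPred_mulVec_injective (hn : 0 < n) (hκ : 0 ≤ κ) (hS : (ridgeCov Y κ).PosDef)
    (hM : (dropIdx A i).PosDef) (b : Bd G i → ℝ) (hb : pseudoPred Y κ G A i *ᵥ b = 0) : b = 0 := by
  rw [pseudoPred_mulVec] at hb
  set w := (dropIdx A i)⁻¹ *ᵥ Bd.extend G i b with hw
  have h1 : extData Y κ *ᵥ (fun a => if h : a ≠ i then w ⟨a, h⟩ else 0) = 0 := by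
    rw [← hb]
    funext k
    rw [mulVec, dotProduct, Fintype.sum_eq_add_sum_subtype_ne _ i]
    simp only [ne_eq, not_true_eq_false, dite_false, mul_zero, zero_add]
    refine Finset.sum_congr rfl fun j _ => ?_
    simp [j.2]
  have h2 := extData_mulVec_injective Y hn hκ hS h1
  have hw0 : w = 0 := by
    funext j
    have := congrFun h2 j.1
    simpa [j.2] using this
  have h3 : Bd.extend G i b = 0 := by
    have h4 : dropIdx A i *ᵥ w = Bd.extend G i b := by
      rw [hw, mulVec_mulVec, mul_nonsing_inv _ hM.det_pos.ne'.isUnit, one_mulVec]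
    rw [← h4, hw0, mulVec_zero]
  funext j
  rw [← Bd.extend_incl G b j, h3]
  rfl

theorem pseudoPred_gram_pos (hn : 0 < n) (hκ : 0 ≤ κ) (hS : (ridgeCov Y κ).PosDef)
    (hM : (dropIdx A i).PosDef) (j : Bd G i) :
    0 < ((pseudoPred Y κ G A i)ᵀ * pseudoPred Y κ G A i) j j := by
  rw [mul_apply]
  refine lt_of_le_of_ne (Finset.sum_nonneg fun k _ => mul_self_nonneg _) fun h => ?_
  have h1 := (Finset.sum_eq_zero_iff_of_nonneg (fun k _ => mul_self_nonneg _)).1 h.symm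
  have h2 : pseudoPred Y κ G A i *ᵥ Pi.single j 1 = 0 := by
    funext k
    have := h1 k (Finset.mem_univ k)
    simpa using this
  have h3 := congrFun (pseudoPred_mulVec_injective Y G hn hκ hS hM _ h2) j
  simp at h3

/-- The determinant contributes `log τ`, the rank-one part of the inverse contributes the residual
sum of squares over `τ`, and each `|b j|` occurs in a row and in a column. The rest depends only on
the block, so one constant serves for all `τ` and `b`. -/
theorem exists_penObjective_replaceIdx (lam : ℝ) (hn : 0 < n) (hκ : 0 ≤ κ)
    (hM : (dropIdx A i).PosDef) : ∃ c : ℝ, ∀ (τ : ℝ) (b : Bd G i → ℝ), 0 < τ →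
    penObjective Y lam κ (replaceIdx A i τ (Bd.extend G i b)) =
      c - cdObj n (fun k => extData Y κ k i) (pseudoPred Y κ G A i) lam τ b := by
  refine ⟨-Real.log (dropIdx A i).det - (padIdx i (dropIdx A i)⁻¹ * ridgeCov Y κ).trace -
    lam * (∑ j, ∑ k, if j ≠ k then |dropIdx A i j k| else 0), fun τ b hτ => ?_⟩
  rw [penObjective_eq, det_replaceIdx hM, Real.log_mul hM.det_pos.ne' hτ.ne', sum_abs_replaceIdx,
    inv_replaceIdx hM hτ, Matrix.add_mul, trace_add, Matrix.smul_mul, trace_smul, vecMulVec_mul,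
    trace_vecMulVec, dotProduct_comm _ (_ ᵥ* _), ← dotProduct_mulVec, dotProduct_ridgeCov Y hn hκ,
    Bd.sum_extend G b (fun _ x => |x|) (by simp)]
  unfold cdObj cdTau
  simp only [extData_mulVec_residVec, ← pseudoPred_mulVec, smul_eq_mul]
  ring

end

/-! ### Compactness of the superlevel sets of the objective function -/

/-- The matrices of the cone at which the objective function is at least `c`. -/
def superlevel {n p : ℕ} (Y : Matrix (Fin n) (Fin p) ℝ) (lam κ : ℝ) (G : SimpleGraph (Fin p))
    (c : ℝ) : Set (Matrix (Fin p) (Fin p) ℝ) :=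
  {A | A ∈ adaptedCone G ∧ c ≤ penObjective Y lam κ A}

theorem continuousAt_matrix_inv_of_det_ne_zero {m : Type*} [Fintype m] [DecidableEq m]
    {A : Matrix m m ℝ} (hA : A.det ≠ 0) : ContinuousAt Inv.inv A :=
  continuousAt_matrix_inv A (by
    simp only [Ring.inverse_eq_inv']
    exact continuousAt_inv₀ hA)

theorem continuousAt_penObjective {n p : ℕ} (Y : Matrix (Fin n) (Fin p) ℝ) (lam κ : ℝ)
    {A : Matrix (Fin p) (Fin p) ℝ} (hA : A.PosDef) : ContinuousAt (penObjective Y lam κ) A := by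
  have h0 : penObjective Y lam κ = fun A => -Real.log A.det - (A⁻¹ * ridgeCov Y κ).trace -
      lam * ∑ j, ∑ k, if j ≠ k then |A j k| else 0 := funext fun A => penObjective_eq Y lam κ A
  rw [h0]
  refine ContinuousAt.sub (ContinuousAt.sub ?_ ?_) ?_
  · have hd : ContinuousAt (fun B : Matrix (Fin p) (Fin p) ℝ => B.det) A :=
      continuous_id.matrix_det.continuousAt
    exact (hd.log hA.det_pos.ne').neg
  · have hc : Continuous fun B : Matrix (Fin p) (Fin p) ℝ => (B * ridgeCov Y κ).trace :=
      (continuous_id.matrix_mul continuous_const).matrix_trace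
    exact hc.continuousAt.comp (continuousAt_matrix_inv_of_det_ne_zero hA.det_pos.ne')
  · refine Continuous.continuousAt (continuous_const.mul ?_)
    refine continuous_finsetSum _ fun j _ => continuous_finsetSum _ fun k _ => ?_
    by_cases h : j ≠ k
    · simp only [if_pos h]
      exact (continuous_id.matrix_elem j k).abs
    · simp only [if_neg h]
      exact continuous_const

/-- Applied to each eigenvalue, `log x ≤ x/2 - 1 + log 2` and `log 2 < 1`. The factor one half
leaves part of `-tr B` to bound the trace on superlevel sets. -/
theorem log_det_le_half_trace {p : ℕ} {B : Matrix (Fin p) (Fin p) ℝ} (hB : B.PosDef) :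
    Real.log B.det ≤ B.trace / 2 := by
  have hdet := hB.1.det_eq_prod_eigenvalues
  have htr := hB.1.trace_eq_sum_eigenvalues
  simp only [RCLike.ofReal_real_eq_id, id_eq] at hdet htr
  rw [hdet, htr, Real.log_prod fun i _ => (hB.eigenvalues_pos i).ne', Finset.sum_div]
  refine Finset.sum_le_sum fun i _ => ?_
  have hpos := hB.eigenvalues_pos i
  have h1 := Real.log_le_sub_one_of_pos (half_pos hpos)
  rw [Real.log_div hpos.ne' two_ne_zero] at h1
  have h2 := Real.log_two_lt_d9
  linarith

/-- Test the quadratic form at `e_i + e_j` and `e_i - e_j`. -/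
theorem PosSemidef.abs_apply_le_trace {p : ℕ} {B : Matrix (Fin p) (Fin p) ℝ}
    (hB : B.PosSemidef) (i j : Fin p) : |B i j| ≤ B.trace := by
  have hdiag : ∀ k, B k k ≤ B.trace := fun k =>
    Finset.single_le_sum (f := fun k => B k k) (fun k _ => hB.diag_nonneg) (Finset.mem_univ k)
  have hsymm : B j i = B i j := by simpa using hB.1.apply i j
  have h1 : ∀ x y : ℝ, 0 ≤ x * (B i i * x + B i j * y) + y * (B j i * x + B j j * y) := by
    intro x y
    have h := hB.dotProduct_mulVec_nonneg (Pi.single i x + Pi.single j y)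
    simp only [star_trivial, mulVec_add, add_dotProduct, single_dotProduct, mulVec_single,
      Pi.add_apply, Pi.smul_apply, col_apply, MulOpposite.smul_eq_mul_unop,
      MulOpposite.unop_op] at h
    linarith
  have h2 := h1 1 1
  have h3 := h1 1 (-1)
  rw [hsymm] at h2 h3
  have h4 := hdiag i
  have h5 := hdiag j
  rw [abs_le]
  constructor <;> linarith

theorem isCompact_posSemidef_trace_le_det_ge (p : ℕ) (R δ : ℝ) :
    IsCompact {B : Matrix (Fin p) (Fin p) ℝ | B.PosSemidef ∧ B.trace ≤ R ∧ δ ≤ B.det} := by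
  have hbox : IsCompact (Set.pi Set.univ fun _ : Fin p => Set.pi Set.univ fun _ : Fin p =>
      Set.Icc (-R) R) := isCompact_univ_pi fun _ => isCompact_univ_pi fun _ => isCompact_Icc
  refine IsCompact.of_isClosed_subset (s := Set.pi Set.univ fun _ : Fin p =>
    Set.pi Set.univ fun _ : Fin p => Set.Icc (-R) R) hbox ?_ ?_
  · have h1 : IsClosed {B : Matrix (Fin p) (Fin p) ℝ | B.PosSemidef} := by
      have : {B : Matrix (Fin p) (Fin p) ℝ | B.PosSemidef} =
          {B | Bᴴ = B} ∩ ⋂ x : Fin p → ℝ, {B | 0 ≤ star x ⬝ᵥ (B *ᵥ x)} := by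
        ext B
        simp [posSemidef_iff_dotProduct_mulVec, IsHermitian]
      rw [this]
      refine (isClosed_eq continuous_id.matrix_conjTranspose continuous_id).inter
        (isClosed_iInter fun x => isClosed_le continuous_const ?_)
      exact continuous_const.dotProduct (continuous_id.matrix_mulVec continuous_const)
    exact h1.inter ((isClosed_le continuous_id.matrix_trace continuous_const).inter
      (isClosed_le continuous_const continuous_id.matrix_det))
  · rintro B ⟨hB, hR, -⟩ i - j -
    exact abs_le.1 ((PosSemidef.abs_apply_le_trace hB i j).trans hR)

open scoped MatrixOrder Matrix.Norms.L2Operator in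
theorem PosDef.exists_eq_conjTranspose_mul_self {p : ℕ} {S : Matrix (Fin p) (Fin p) ℝ}
    (hS : S.PosDef) : ∃ C : Matrix (Fin p) (Fin p) ℝ, C.det ≠ 0 ∧ S = Cᴴ * C := by
  obtain ⟨C, hC⟩ := CStarAlgebra.nonneg_iff_eq_star_mul_self.mp hS.posSemidef.nonneg
  refine ⟨C, fun h => hS.det_pos.ne' ?_, hC⟩
  rw [hC, det_mul, h, mul_zero]

section

variable {n p : ℕ} (Y : Matrix (Fin n) (Fin p) ℝ) {lam κ : ℝ}

/-- The objective function in terms of the standardized concentration matrix. -/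
theorem penObjective_le_standardized (hlam : 0 ≤ lam) {C : Matrix (Fin p) (Fin p) ℝ}
    (hC : C.det ≠ 0) (hS : ridgeCov Y κ = Cᴴ * C) {A : Matrix (Fin p) (Fin p) ℝ}
    (hA : A.PosDef) :
    (C * A⁻¹ * Cᴴ).PosDef ∧ penObjective Y lam κ A ≤
      Real.log (C * A⁻¹ * Cᴴ).det - (C * A⁻¹ * Cᴴ).trace - Real.log (C.det * C.det) := by
  have hpd : (C * A⁻¹ * Cᴴ).PosDef := by
    refine hA.inv.mul_mul_conjTranspose_same ?_
    rw [vecMul_injective_iff_isUnit, isUnit_iff_isUnit_det]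
    exact hC.isUnit
  refine ⟨hpd, ?_⟩
  rw [penObjective_eq, hS, ← Matrix.mul_assoc, det_mul, det_mul,
    det_conjTranspose, star_trivial, det_nonsing_inv, Ring.inverse_eq_inv']
  have h1 : C.det * (A.det)⁻¹ * C.det = (C.det * C.det) * (A.det)⁻¹ := by ring
  rw [h1, Real.log_mul (mul_ne_zero hC hC) (inv_ne_zero hA.det_pos.ne'), Real.log_inv]
  have h2 : 0 ≤ lam * ∑ j, ∑ k, if j ≠ k then |A j k| else 0 := by
    refine mul_nonneg hlam (Finset.sum_nonneg fun j _ => Finset.sum_nonneg fun k _ => ?_)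
    split_ifs
    · exact abs_nonneg _
    · exact le_rfl
  have h3 : (A⁻¹ * Cᴴ * C).trace = (C * A⁻¹ * Cᴴ).trace := by
    rw [trace_mul_comm, Matrix.mul_assoc]
  linarith

theorem exists_penObjective_le (hlam : 0 ≤ lam) (hS : (ridgeCov Y κ).PosDef) :
    ∃ M, ∀ A : Matrix (Fin p) (Fin p) ℝ, A.PosDef → penObjective Y lam κ A ≤ M := by
  obtain ⟨C, hC, hSC⟩ := PosDef.exists_eq_conjTranspose_mul_self hS
  refine ⟨-Real.log (C.det * C.det), fun A hA => ?_⟩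
  obtain ⟨h1, h2⟩ := penObjective_le_standardized Y hlam hC hSC hA
  have h3 := log_det_le_half_trace h1
  have h4 := h1.posSemidef.trace_nonneg
  linarith

/-- For `B = C Σ⁻¹ Cᴴ`, the inequalities `c' ≤ log det B - tr B` and `log det B ≤ tr B / 2` bound
the trace above and the determinant away from zero. Such `B` form a compact set of positive definite
matrices, and inversion, continuous there, carries it to a compact set containing all admissible
`Σ`. -/
theorem isCompact_superlevel (hlam : 0 ≤ lam) (hS : (ridgeCov Y κ).PosDef)
    (G : SimpleGraph (Fin p)) (c : ℝ) : IsCompact (superlevel Y lam κ G c) := by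
  obtain ⟨C, hC, hSC⟩ := PosDef.exists_eq_conjTranspose_mul_self hS
  set c' := c + Real.log (C.det * C.det) with hc'
  set Q := {B : Matrix (Fin p) (Fin p) ℝ | B.PosSemidef ∧ B.trace ≤ -2 * c' ∧ Real.exp c' ≤ B.det}
    with hQ
  have hQc : IsCompact Q := isCompact_posSemidef_trace_le_det_ge p _ _
  have hQpd : ∀ B ∈ Q, B.PosDef := fun B hB => by
    rw [hB.1.posDef_iff_det_ne_zero]
    exact ((Real.exp_pos _).trans_le hB.2.2).ne'
  have hCu : IsUnit C := (isUnit_iff_isUnit_det _).2 hC.isUnit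
  set Q' := (fun B : Matrix (Fin p) (Fin p) ℝ => Cᴴ * B⁻¹ * C) '' Q with hQ'
  have hQ'c : IsCompact Q' := by
    refine hQc.image_of_continuousOn fun B hB => ContinuousAt.continuousWithinAt ?_
    have h1 : Continuous fun B : Matrix (Fin p) (Fin p) ℝ => Cᴴ * B * C :=
      (continuous_const.matrix_mul continuous_id).matrix_mul continuous_const
    exact h1.continuousAt.comp (continuousAt_matrix_inv_of_det_ne_zero (hQpd B hB).det_pos.ne')
  have hQ'pd : ∀ A ∈ Q', A.PosDef := by
    rintro _ ⟨B, hB, rfl⟩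
    exact (hQpd B hB).inv.conjTranspose_mul_mul_same (mulVec_injective_of_isUnit hCu)
  have hsub : superlevel Y lam κ G c ⊆ Q' := by
    rintro A ⟨hA, hcA⟩
    obtain ⟨h1, h2⟩ := penObjective_le_standardized Y hlam hC hSC hA.1
    have h3 := log_det_le_half_trace h1
    have h4 := h1.posSemidef.trace_nonneg
    refine ⟨C * A⁻¹ * Cᴴ, ⟨h1.posSemidef, by linarith, ?_⟩, ?_⟩
    · rw [← Real.le_log_iff_exp_le h1.det_pos]
      linarith
    · have hCd : IsUnit C.det := hC.isUnit
      have hCd' : IsUnit (Cᴴ).det := by rw [det_conjTranspose]; simpa using hC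
      have hAd : IsUnit A.det := hA.1.det_pos.ne'.isUnit
      simp only
      rw [Matrix.mul_inv_rev, Matrix.mul_inv_rev, nonsing_inv_nonsing_inv _ hAd,
        ← Matrix.mul_assoc, mul_nonsing_inv _ hCd', Matrix.one_mul, Matrix.mul_assoc,
        nonsing_inv_mul _ hCd, Matrix.mul_one]
  -- The positive definite cone need not be closed, but within `Q'` positive definiteness is
  -- automatic and only closed conditions remain.
  have heq : superlevel Y lam κ G c =
      {A | ∀ j k, j ≠ k → ¬ G.Adj j k → A j k = 0} ∩ (Q' ∩ penObjective Y lam κ ⁻¹' Set.Ici c) := by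
    ext A
    constructor
    · intro hA
      exact ⟨hA.1.2, hsub hA, hA.2⟩
    · rintro ⟨h1, h2, h3⟩
      exact ⟨⟨hQ'pd A h2, h1⟩, h3⟩
  have hcl : IsClosed {A : Matrix (Fin p) (Fin p) ℝ | ∀ j k, j ≠ k → ¬ G.Adj j k → A j k = 0} := by
    simp only [Set.ofPred_forall]
    exact isClosed_iInter fun j => isClosed_iInter fun k => isClosed_iInter fun _ =>
      isClosed_iInter fun _ => isClosed_eq (continuous_id.matrix_elem j k) continuous_const
  have hF : ContinuousOn (penObjective Y lam κ) Q' := fun A hA =>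
    (continuousAt_penObjective Y lam κ (hQ'pd A hA)).continuousWithinAt
  have hcl2 : IsClosed (Q' ∩ penObjective Y lam κ ⁻¹' Set.Ici c) :=
    hF.preimage_isClosed_of_isClosed hQ'c.isClosed isClosed_Ici
  rw [heq]
  exact hQ'c.of_isClosed_subset (hcl.inter hcl2) fun A hA => hA.2.1

end

/-! ### Limits of iterations of maps that increase a function -/

/-- `x'` is one of the iterates of `x` under `T`, or their limit. -/
def IsOrbitOutput {X : Type*} [TopologicalSpace X] (T : X → X) (x x' : X) : Prop :=
  (∃ m : ℕ, x' = T^[m + 1] x) ∨ Tendsto (fun m => T^[m] x) atTop (𝓝 x')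

section

variable {X : Type*} [TopologicalSpace X] [T2Space X] {K : Set X} {T : X → X} {F : X → ℝ}

omit [TopologicalSpace X] [T2Space X] in
theorem monotone_iterate (hTK : Set.MapsTo T K K) (hle : ∀ x ∈ K, F x ≤ F (T x)) {x : X}
    (hx : x ∈ K) : Monotone fun m => F (T^[m] x) := by
  refine monotone_nat_of_le_succ fun m => ?_
  rw [Function.iterate_succ_apply']
  exact hle _ (hTK.iterate m hx)

theorem IsOrbitOutput.mem (hK : IsCompact K) (hTK : Set.MapsTo T K K) {x x' : X} (hx : x ∈ K)
    (h : IsOrbitOutput T x x') : x' ∈ K := by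
  rcases h with ⟨m, rfl⟩ | h
  · exact hTK.iterate _ hx
  · exact hK.isClosed.mem_of_tendsto h (Eventually.of_forall fun m => hTK.iterate m hx)

theorem IsOrbitOutput.tendsto_comp (hK : IsCompact K) (hTK : Set.MapsTo T K K)
    (hF : ContinuousOn F K) {x x' : X} (hx : x ∈ K)
    (h : Tendsto (fun m => T^[m] x) atTop (𝓝 x')) :
    Tendsto (fun m => F (T^[m] x)) atTop (𝓝 (F x')) := by
  have hx' : x' ∈ K := IsOrbitOutput.mem hK hTK hx (Or.inr h)
  exact (hF x' hx').tendsto.comp (tendsto_nhdsWithin_iff.2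
    ⟨h, Eventually.of_forall fun m => hTK.iterate m hx⟩)

theorem IsOrbitOutput.le (hK : IsCompact K) (hTK : Set.MapsTo T K K)
    (hF : ContinuousOn F K) (hle : ∀ x ∈ K, F x ≤ F (T x)) {x x' : X} (hx : x ∈ K)
    (h : IsOrbitOutput T x x') : F x ≤ F x' := by
  have hm := monotone_iterate (F := F) hTK hle hx
  rcases h with ⟨m, rfl⟩ | h
  · exact hm (Nat.zero_le (m + 1))
  · exact hm.ge_of_tendsto (IsOrbitOutput.tendsto_comp hK hTK hF hx h) 0

/-- An orbit that leaves the set `d < ε` does so in a single step. -/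
theorem IsOrbitOutput.exists_crossing (hK : IsCompact K) (hTK : Set.MapsTo T K K)
    (hF : ContinuousOn F K) (hle : ∀ x ∈ K, F x ≤ F (T x)) {x x' : X} (hx : x ∈ K)
    (h : IsOrbitOutput T x x') {d : X → ℝ} (hd : Continuous d) {ε : ℝ} (h1 : d x < ε)
    (h2 : ε < d x') :
    ∃ m, d (T^[m] x) < ε ∧ ε ≤ d (T^[m + 1] x) ∧ F (T^[m + 1] x) ≤ F x' := by
  have hm := monotone_iterate (F := F) hTK hle hx
  -- If the output is only a limit, some iterate is already beyond `ε`, because `ε < d x'` is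
  -- strict.
  obtain ⟨N, hN, hNF⟩ : ∃ N, ε ≤ d (T^[N] x) ∧ ∀ m ≤ N, F (T^[m] x) ≤ F x' := by
    rcases h with ⟨N, rfl⟩ | h
    · exact ⟨N + 1, h2.le, fun m hmN => hm hmN⟩
    · obtain ⟨N, hN⟩ := (Tendsto.eventually_const_lt h2 ((hd.tendsto x').comp h)).exists
      exact ⟨N, hN.le, fun m _ =>
        hm.ge_of_tendsto (IsOrbitOutput.tendsto_comp hK hTK hF hx h) m⟩
  -- The crossing is the step just before the first exit time, which is not `0` since the orbit
  -- starts inside.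
  classical
  have hex : ∃ N, ε ≤ d (T^[N] x) := ⟨N, hN⟩
  have hne : Nat.find hex ≠ 0 := by
    intro h0
    have := Nat.find_spec hex
    rw [h0] at this
    exact absurd h1 (not_lt.2 this)
  obtain ⟨m, hmeq⟩ := Nat.exists_eq_succ_of_ne_zero hne
  refine ⟨m, ?_, ?_, ?_⟩
  · exact not_le.1 (Nat.find_min hex (by omega))
  · have := Nat.find_spec hex
    rwa [hmeq] at this
  · have := Nat.find_min' hex hN
    exact hNF _ (by omega)

omit [T2Space X] in
theorem IsCompact.exists_tendsto_ultrafilter {ι : Type*} (hK : IsCompact K) (U : Ultrafilter ι)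
    {zs : ι → X} (hzs : ∀ᶠ k in (U : Filter ι), zs k ∈ K) :
    ∃ z ∈ K, Tendsto zs U (𝓝 z) := by
  obtain ⟨z, hz, hle⟩ := hK.ultrafilter_le_nhds (U.map zs) (by
    rw [Ultrafilter.coe_map, Filter.le_principal_iff]
    exact hzs)
  exact ⟨z, hz, hle⟩

/-- If the values of `F` do not increase in the limit, then the limit of the starting points of the
orbits is a fixed point and also the limit of the outputs, provided that the fixed points that can
be reached are isolated. -/
theorem IsOrbitOutput.tendsto_of_finite_fixedPoints {ι Q : Type*} [TopologicalSpace Q] [T2Space Q]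
    (U : Ultrafilter ι) (hK : IsCompact K) (hTK : Set.MapsTo T K K) (hT : ContinuousOn T K)
    (hF : ContinuousOn F K) (hle : ∀ x ∈ K, F x ≤ F (T x))
    (heq : ∀ x ∈ K, F (T x) ≤ F x → T x = x) {q : X → Q} (hq : Continuous q)
    (hqT : ∀ x, q (T x) = q x) {xs xs' : ι → X} {x : X} {v : ℝ} (hxK : x ∈ K)
    (hxs : ∀ᶠ k in (U : Filter ι), xs k ∈ K) (hx : Tendsto xs U (𝓝 x))
    (hstep : ∀ᶠ k in (U : Filter ι), IsOrbitOutput T (xs k) (xs' k))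
    (hv : Tendsto (fun k => F (xs k)) U (𝓝 v)) (hv' : Tendsto (fun k => F (xs' k)) U (𝓝 v))
    (hfin : {z ∈ K | T z = z ∧ q z = q x}.Finite) {d : X → ℝ} (hd : Continuous d)
    (hd0 : ∀ z, 0 ≤ d z) (hdx : ∀ z, d z = 0 ↔ z = x) :
    T x = x ∧ Tendsto xs' U (𝓝 x) := by
  have hFlim : ∀ {zs : ι → X} {z : X}, (∀ᶠ k in (U : Filter ι), zs k ∈ K) → z ∈ K →
      Tendsto zs U (𝓝 z) → Tendsto (fun k => F (zs k)) U (𝓝 (F z)) := fun hzs hz h =>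
    (hF _ hz).tendsto.comp (tendsto_nhdsWithin_iff.2 ⟨h, hzs⟩)
  have hTlim : ∀ {zs : ι → X} {z : X}, (∀ᶠ k in (U : Filter ι), zs k ∈ K) → z ∈ K →
      Tendsto zs U (𝓝 z) → Tendsto (fun k => T (zs k)) U (𝓝 (T z)) := fun hzs hz h =>
    (hT _ hz).tendsto.comp (tendsto_nhdsWithin_iff.2 ⟨h, hzs⟩)
  have hxs'K : ∀ᶠ k in (U : Filter ι), xs' k ∈ K := by
    filter_upwards [hxs, hstep] with k h1 h2 using h2.mem hK hTK h1
  -- The values at `zs` and after one more step lie between those at the starts and at the outputs,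
  -- which share the limit `v`. So `T` gains nothing at the limit `z`, and `z` is fixed.
  have hkey : ∀ {zs : ι → X} {z : X}, (∀ᶠ k in (U : Filter ι), zs k ∈ K) → z ∈ K →
      Tendsto zs U (𝓝 z) → (∀ᶠ k in (U : Filter ι), F (xs k) ≤ F (zs k)) →
      (∀ᶠ k in (U : Filter ι), F (T (zs k)) ≤ F (xs' k)) → T z = z := by
    intro zs z hzs hz hlim h1 h2
    refine heq z hz ?_
    have h3 : v ≤ F z := le_of_tendsto_of_tendsto hv (hFlim hzs hz hlim) h1
    have hTz := hFlim (hzs.mono fun k hk => hTK hk) (hTK hz) (hTlim hzs hz hlim)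
    exact (le_of_tendsto_of_tendsto hTz hv' h2).trans h3
  have hfix : T x = x := by
    refine hkey hxs hxK hx (Eventually.of_forall fun _ => le_rfl) ?_
    filter_upwards [hxs, hstep] with k h1 h2
    have hm := monotone_iterate (F := F) hTK hle h1
    rcases h2 with ⟨m, hm'⟩ | h2
    · rw [hm']
      exact hm (Nat.le_add_left 1 m)
    · exact hm.ge_of_tendsto (IsOrbitOutput.tendsto_comp hK hTK hF h1 h2) 1
  refine ⟨hfix, ?_⟩
  obtain ⟨x', hx'K, hx'⟩ := hK.exists_tendsto_ultrafilter U hxs'K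
  suffices hxx : x' = x by rwa [hxx] at hx'
  by_contra hne
  have hpos : 0 < d x' := lt_of_le_of_ne (hd0 x') fun h => hne ((hdx x').1 h.symm)
  -- Each radius below `d x'` yields a fixed point at exactly that radius, and there are infinitely
  -- many radii.
  have hsphere : ∀ ε ∈ Set.Ioo 0 (d x'), ∃ z ∈ {z ∈ K | T z = z ∧ q z = q x}, d z = ε := by
    rintro ε ⟨hε0, hε1⟩
    have hd1 : ∀ᶠ k in (U : Filter ι), d (xs k) < ε := by
      refine ((hd.tendsto x).comp hx).eventually_lt_const ?_
      rwa [(hdx x).2 rfl]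
    have hd2 : ∀ᶠ k in (U : Filter ι), ε < d (xs' k) :=
      Tendsto.eventually_const_lt hε1 ((hd.tendsto x').comp hx')
    have hex : ∀ k, ∃ m, (xs k ∈ K ∧ IsOrbitOutput T (xs k) (xs' k) ∧ d (xs k) < ε ∧
        ε < d (xs' k)) → d (T^[m] (xs k)) < ε ∧ ε ≤ d (T^[m + 1] (xs k)) ∧
          F (T^[m + 1] (xs k)) ≤ F (xs' k) := by
      intro k
      by_cases h : xs k ∈ K ∧ IsOrbitOutput T (xs k) (xs' k) ∧ d (xs k) < ε ∧ ε < d (xs' k)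
      · obtain ⟨m, hm⟩ := h.2.1.exists_crossing hK hTK hF hle h.1 hd h.2.2.1 h.2.2.2
        exact ⟨m, fun _ => hm⟩
      · exact ⟨0, fun h' => absurd h' h⟩
    choose m hm using hex
    have hm' : ∀ᶠ k in (U : Filter ι), d (T^[m k] (xs k)) < ε ∧ ε ≤ d (T^[m k + 1] (xs k)) ∧
        F (T^[m k + 1] (xs k)) ≤ F (xs' k) := by
      filter_upwards [hxs, hstep, hd1, hd2] with k h1 h2 h3 h4 using hm k ⟨h1, h2, h3, h4⟩
    have hzsK : ∀ᶠ k in (U : Filter ι), T^[m k] (xs k) ∈ K :=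
      hxs.mono fun k hk => hTK.iterate _ hk
    obtain ⟨z, hzK, hz⟩ := hK.exists_tendsto_ultrafilter U hzsK
    have hTz : T z = z := by
      refine hkey hzsK hzK hz ?_ ?_
      · filter_upwards [hxs] with k hk
        exact monotone_iterate (F := F) hTK hle hk (Nat.zero_le (m k))
      · filter_upwards [hm'] with k hk
        have := hk.2.2
        rwa [Function.iterate_succ_apply'] at this
    have hqit : ∀ (r : ℕ) (w : X), q (T^[r] w) = q w := by
      intro r w
      induction r with
      | zero => rfl
      | succ r ih => rw [Function.iterate_succ_apply', hqT, ih]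
    have hqz : q z = q x := by
      refine tendsto_nhds_unique ((hq.tendsto z).comp hz) ?_
      have : (q ∘ fun k => T^[m k] (xs k)) = q ∘ xs := by
        funext k; exact hqit _ _
      rw [this]
      exact (hq.tendsto x).comp hx
    -- The points before the crossing satisfy `d < ε` and those after it `ε ≤ d`; both tend to `z`,
    -- since `T z = z`.
    refine ⟨z, ⟨hzK, hTz, hqz⟩, le_antisymm ?_ ?_⟩
    · exact le_of_tendsto ((hd.tendsto z).comp hz) (hm'.mono fun k hk => hk.1.le)
    · have h5 := hTlim hzsK hzK hz
      rw [hTz] at h5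
      refine ge_of_tendsto ((hd.tendsto z).comp h5) (hm'.mono fun k hk => ?_)
      have := hk.2.1
      rwa [Function.iterate_succ_apply'] at this
  have hinf : (Set.Ioo 0 (d x')).Infinite := Set.Ioo_infinite hpos
  exact hinf ((hfin.image d).subset fun ε hε => by
    obtain ⟨z, hz, hzε⟩ := hsphere ε hε
    exact ⟨z, hz, hzε⟩)

end

/-! ### One pass of the vertex update, as a map on matrices -/

section

variable {n p : ℕ} (Y : Matrix (Fin n) (Fin p) ℝ) (lam κ : ℝ) (G : SimpleGraph (Fin p))
  [DecidableRel G.Adj] (i : Fin p)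

/-- The coefficients of `bd(i)` in the column `i`. -/
def bdCol (A : Matrix (Fin p) (Fin p) ℝ) : Bd G i → ℝ := fun j => A j.1 i

/-- The error variance computed at the start of a pass. -/
def passTau (A : Matrix (Fin p) (Fin p) ℝ) : ℝ :=
  cdTau n (fun k => extData Y κ k i) (pseudoPred Y κ G A i) (bdCol G i A)

/-- The effect of a single pass of the update of the vertex `i`. -/
def passMap (A : Matrix (Fin p) (Fin p) ℝ) : Matrix (Fin p) (Fin p) ℝ :=
  replaceIdx A i (passTau Y κ G i A) (Bd.extend G i
    (cdPass n (fun k => extData Y κ k i) (pseudoPred Y κ G A i) lam (bdCol G i A)))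

variable {Y lam κ G i} {A : Matrix (Fin p) (Fin p) ℝ}

omit [DecidableRel G.Adj] in
theorem pseudoPred_replaceIdx (τ : ℝ) (s : {j : Fin p // j ≠ i} → ℝ) :
    pseudoPred Y κ G (replaceIdx A i τ s) i = pseudoPred Y κ G A i := by
  unfold pseudoPred
  rw [dropIdx_replaceIdx]

theorem bdCol_replaceIdx (τ : ℝ) (b : Bd G i → ℝ) :
    bdCol G i (replaceIdx A i τ (Bd.extend G i b)) = b := by
  funext j
  exact (replaceIdx_right τ _ (Bd.incl G i j)).trans (Bd.extend_incl G b j)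

theorem replaceIdx_replaceIdx (τ τ' : ℝ) (s s' : {j : Fin p // j ≠ i} → ℝ) :
    replaceIdx (replaceIdx A i τ s) i τ' s' = replaceIdx A i τ' s' :=
  replaceIdx_congr (dropIdx_replaceIdx τ s) τ' s'

theorem passMap_replaceIdx (τ : ℝ) (b : Bd G i → ℝ) :
    passMap Y lam κ G i (replaceIdx A i τ (Bd.extend G i b)) =
      replaceIdx A i (cdTau n (fun k => extData Y κ k i) (pseudoPred Y κ G A i) b)
        (Bd.extend G i (cdPass n (fun k => extData Y κ k i) (pseudoPred Y κ G A i) lam b)) := by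
  unfold passMap passTau
  rw [pseudoPred_replaceIdx, bdCol_replaceIdx, replaceIdx_replaceIdx]

/-- The count starts at one pass because the initial matrix need not have the form on the right: its
zero pattern is arbitrary. -/
theorem iterate_passMap (r : ℕ) :
    (passMap Y lam κ G i)^[r + 1] A =
      replaceIdx A i (cdState n (fun k => extData Y κ k i) (pseudoPred Y κ G A i) lam
          (bdCol G i A) r).1
        (Bd.extend G i (cdState n (fun k => extData Y κ k i) (pseudoPred Y κ G A i) lam
          (bdCol G i A) r).2) := by
  induction r with
  | zero => rfl
  | succ r ih =>
    rw [Function.iterate_succ_apply', ih, passMap_replaceIdx]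
    simp only [cdState, cdIter]
    rw [Function.iterate_succ_apply' (cdPass n (fun k => extData Y κ k i) (pseudoPred Y κ G A i) lam)
      (r + 1)]

theorem dropIdx_passMap : dropIdx (passMap Y lam κ G i A) i = dropIdx A i :=
  dropIdx_replaceIdx _ _

theorem continuous_replaceIdx_extend : Continuous fun q : ℝ × (Bd G i → ℝ) =>
    replaceIdx A i q.1 (Bd.extend G i q.2) := by
  have hext : Continuous fun q : ℝ × (Bd G i → ℝ) => Bd.extend G i q.2 := by
    refine continuous_pi fun j => ?_
    unfold Bd.extend
    by_cases h : G.Adj i j.1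
    · simp only [h, dite_true]; fun_prop
    · simp only [h, dite_false]; fun_prop
  refine continuous_matrix fun a b => ?_
  by_cases ha : a = i
  · by_cases hb : b = i
    · simp only [replaceIdx, of_apply, ha, hb, dite_true]
      exact continuous_fst.add (hext.dotProduct (continuous_const.matrix_mulVec hext))
    · simp only [replaceIdx, of_apply, ha, hb, dite_true, dite_false]
      exact (continuous_apply (⟨b, hb⟩ : {j : Fin p // j ≠ i})).comp hext
  · by_cases hb : b = i
    · simp only [replaceIdx, of_apply, ha, hb, dite_false, if_true]
      exact (continuous_apply (⟨a, ha⟩ : {j : Fin p // j ≠ i})).comp hext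
    · simp only [replaceIdx, of_apply, ha, hb, dite_false, if_false]
      exact continuous_const

theorem IsVertexUpdate.isOrbitOutput {A' : Matrix (Fin p) (Fin p) ℝ}
    (h : IsVertexUpdate Y lam κ G i A A') : IsOrbitOutput (passMap Y lam κ G i) A A' := by
  obtain ⟨τ, b, h1, h2, rfl⟩ := h
  rcases isEmpty_or_nonempty (Bd G i) with he | hne
  · refine Or.inl ⟨0, ?_⟩
    rw [Function.iterate_one, passMap, passTau, h2 he, Subsingleton.elim b]
    congr 1
    unfold cdTau
    congr 1
    refine Finset.sum_congr rfl fun k _ => ?_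
    rw [Subsingleton.elim (bdCol G i A) 0, mulVec_zero]
    simp [sq]
  · rcases h1 hne with ⟨r, hr⟩ | hlim
    · refine Or.inl ⟨r, ?_⟩
      rw [iterate_passMap]
      change _ = replaceIdx A i (cdState n (fun k => extData Y κ k i) (pseudoPred Y κ G A i) lam
          (fun j => A j.1 i) r).1 (Bd.extend G i (cdState n (fun k => extData Y κ k i)
          (pseudoPred Y κ G A i) lam (fun j => A j.1 i) r).2)
      rw [← hr]
    · refine Or.inr ?_
      rw [← tendsto_add_atTop_iff_nat 1]
      have := ((continuous_replaceIdx_extend (A := A) (G := G) (i := i)).tendsto (τ, b)).comp hlim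
      refine this.congr fun r => ?_
      exact (iterate_passMap r).symm

theorem passTau_pos (hn : 0 < n) (hκ : 0 ≤ κ) (hS : (ridgeCov Y κ).PosDef) :
    0 < passTau Y κ G i A :=
  cdTau_pos hn (pseudoPred_mulVec_ne Y G hn hκ hS) _

/-- Nothing is required of `A`, so this covers a start outside the cone. When the loop is run to its
limit, continuity gives `τ = cdTau b` there, so positivity is not lost. -/
theorem IsVertexUpdate.exists_eq_replaceIdx (hn : 0 < n) (hκ : 0 ≤ κ)
    (hS : (ridgeCov Y κ).PosDef) {A' : Matrix (Fin p) (Fin p) ℝ}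
    (h : IsVertexUpdate Y lam κ G i A A') :
    ∃ (τ : ℝ) (b : Bd G i → ℝ), 0 < τ ∧ A' = replaceIdx A i τ (Bd.extend G i b) := by
  have hpos : ∀ b : Bd G i → ℝ, 0 < cdTau n (fun k => extData Y κ k i) (pseudoPred Y κ G A i) b :=
    fun b => cdTau_pos hn (pseudoPred_mulVec_ne Y G hn hκ hS) b
  have h' := h.isOrbitOutput
  obtain ⟨τ, b, h1, h2, rfl⟩ := h
  rcases isEmpty_or_nonempty (Bd G i) with he | hne
  · rcases h' with ⟨m, hm⟩ | -
    · rw [iterate_passMap] at hm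
      exact ⟨_, _, hpos _, hm⟩
    · refine ⟨τ, b, ?_, rfl⟩
      rw [h2 he]
      have := hpos b
      rw [Subsingleton.elim b 0] at this
      unfold cdTau at this
      rw [mulVec_zero] at this
      simpa [sq] using this
  · refine ⟨τ, b, ?_, rfl⟩
    rcases h1 hne with ⟨r, hr⟩ | hlim
    · have : τ = _ := congrArg Prod.fst hr
      rw [this]
      exact hpos _
    · have h3 := (continuous_fst.tendsto (τ, b)).comp hlim
      have h4 := (continuous_snd.tendsto (τ, b)).comp hlim
      have h5 : Tendsto (fun r => cdIter n (fun k => extData Y κ k i) (pseudoPred Y κ G A i) lam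
          (fun j => A j.1 i) r) atTop (𝓝 b) := by
        rw [← tendsto_add_atTop_iff_nat 1]
        exact h4
      have h6 := tendsto_cdTau (n := n) (y := fun k => extData Y κ k i)
        (tendsto_const_nhds (x := pseudoPred Y κ G A i)) h5
      have h7 : τ = cdTau n (fun k => extData Y κ k i) (pseudoPred Y κ G A i) b :=
        tendsto_nhds_unique h3 h6
      rw [h7]
      exact hpos b

theorem extend_bdCol (hA : A ∈ adaptedCone G) :
    Bd.extend G i (bdCol G i A) = fun j => A j.1 i := by
  funext j
  unfold Bd.extend bdCol
  by_cases h : G.Adj i j.1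
  · simp [h]
  · rw [dif_neg h, hA.2 j.1 i j.2 fun h' => h h'.symm]

theorem eq_replaceIdx_of_mem_adaptedCone (hA : A ∈ adaptedCone G) (i : Fin p) :
    A = replaceIdx A i (residVar A i) (Bd.extend G i (bdCol G i A)) := by
  rw [extend_bdCol hA, replaceIdx_residVar hA.1.1]

/-- The disjunction lets a matrix outside the cone acquire the zero pattern one vertex at a time. -/
theorem replaceIdx_extend_apply_eq_zero (τ : ℝ) (b : Bd G i → ℝ) {j k : Fin p} (hjk : j ≠ k)
    (hadj : ¬ G.Adj j k) (h : A j k = 0 ∨ j = i ∨ k = i) :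
    replaceIdx A i τ (Bd.extend G i b) j k = 0 := by
  by_cases hj : j = i
  · subst hj
    rw [replaceIdx_left _ _ ⟨k, hjk.symm⟩]
    simp [Bd.extend, hadj]
  · by_cases hk : k = i
    · subst hk
      rw [replaceIdx_right _ _ ⟨j, hjk⟩]
      simp [Bd.extend, show ¬ G.Adj k j from fun h => hadj h.symm]
    · rw [replaceIdx_of_ne _ _ hj hk]
      simpa [hj, hk] using h

theorem replaceIdx_mem_adaptedCone (hA : A ∈ adaptedCone G) {τ : ℝ} (hτ : 0 < τ)
    (b : Bd G i → ℝ) : replaceIdx A i τ (Bd.extend G i b) ∈ adaptedCone G :=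
  ⟨replaceIdx_posDef (dropIdx_posDef hA.1 i) hτ _, fun _ _ hjk hadj =>
    replaceIdx_extend_apply_eq_zero τ b hjk hadj (Or.inl (hA.2 _ _ hjk hadj))⟩

theorem passMap_mem_adaptedCone (hn : 0 < n) (hκ : 0 ≤ κ) (hS : (ridgeCov Y κ).PosDef)
    (hA : A ∈ adaptedCone G) : passMap Y lam κ G i A ∈ adaptedCone G :=
  replaceIdx_mem_adaptedCone hA (passTau_pos hn hκ hS) _

/-- A pass does not decrease the objective function, and if it does not increase it, then the
matrix is unchanged by the pass and by each of its steps. -/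
theorem penObjective_passMap (hn : 0 < n) (hlam : 0 ≤ lam) (hκ : 0 ≤ κ)
    (hS : (ridgeCov Y κ).PosDef) (hA : A ∈ adaptedCone G) (i : Fin p) :
    penObjective Y lam κ A ≤ penObjective Y lam κ (passMap Y lam κ G i A) ∧
    (penObjective Y lam κ (passMap Y lam κ G i A) ≤ penObjective Y lam κ A →
      passMap Y lam κ G i A = A ∧ residVar A i = passTau Y κ G i A ∧
      ∀ j, cdCoord n (fun k => extData Y κ k i) (pseudoPred Y κ G A i) lam (passTau Y κ G i A)
        (bdCol G i A) j = bdCol G i A) := by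
  have hM := dropIdx_posDef hA.1 i
  obtain ⟨c, hc⟩ := exists_penObjective_replaceIdx Y G (A := A) (i := i) lam hn hκ hM
  have h1 : penObjective Y lam κ A = _ :=
    (congrArg _ (eq_replaceIdx_of_mem_adaptedCone hA i)).trans (hc _ _ (residVar_pos hA.1 i))
  have h2 : penObjective Y lam κ (passMap Y lam κ G i A) = _ :=
    hc _ _ (passTau_pos hn hκ hS)
  obtain ⟨h3, h4⟩ := cdObj_cdPass_le (y := fun k => extData Y κ k i) hn hlam
    (pseudoPred_gram_pos Y G hn hκ hS hM) (pseudoPred_mulVec_ne Y G hn hκ hS)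
    (residVar_pos hA.1 i) (bdCol G i A)
  rw [h1, h2]
  refine ⟨sub_le_sub_left h3 c, fun h => ?_⟩
  obtain ⟨h5, h6, h7⟩ := h4 (by
    have := h
    unfold passTau at this
    linarith)
  refine ⟨?_, h5, h7⟩
  conv_rhs => rw [eq_replaceIdx_of_mem_adaptedCone hA i]
  rw [passMap, h6, h5]
  rfl

/-- At a matrix that is unchanged by a pass, the objective function cannot be increased by changing
a single parameter. -/
theorem penObjective_replaceIdx_le (hn : 0 < n) (hlam : 0 ≤ lam) (hκ : 0 ≤ κ)
    (hS : (ridgeCov Y κ).PosDef) (hA : A ∈ adaptedCone G) (i : Fin p)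
    (hfix : passMap Y lam κ G i A = A) :
    (∀ τ, 0 < τ → penObjective Y lam κ (replaceIdx A i τ (fun j => A j.1 i)) ≤
      penObjective Y lam κ A) ∧
    (∀ (j : Bd G i) (t : ℝ), penObjective Y lam κ (replaceIdx A i (residVar A i)
      (Bd.extend G i (Function.update (bdCol G i A) j t))) ≤ penObjective Y lam κ A) := by
  have hM := dropIdx_posDef hA.1 i
  obtain ⟨c, hc⟩ := exists_penObjective_replaceIdx Y G (A := A) (i := i) lam hn hκ hM
  have h1 : penObjective Y lam κ A = _ :=
    (congrArg _ (eq_replaceIdx_of_mem_adaptedCone hA i)).trans (hc _ _ (residVar_pos hA.1 i))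
  obtain ⟨-, h5, h6⟩ := (penObjective_passMap (lam := lam) hn hlam hκ hS hA i).2 (by rw [hfix])
  constructor
  · intro τ hτ
    rw [← extend_bdCol hA, hc _ _ hτ, h1]
    refine sub_le_sub_left ?_ c
    rw [h5]
    exact (cdObj_cdTau_le _ (passTau_pos hn hκ hS) hτ).1
  · intro j t
    rw [hc _ _ (residVar_pos hA.1 i), h1]
    refine sub_le_sub_left ?_ c
    have := cdObj_cdCoord_le (y := fun k => extData Y κ k i) hn hlam
      (pseudoPred_gram_pos Y G hn hκ hS hM) (passTau_pos (G := G) (A := A) (i := i) hn hκ hS)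
      (bdCol G i A) j t
    rw [h6 j, ← h5] at this
    exact this

/-- Prescribing the block fixes the regression problem; a fixed matrix is then determined by its
column `i`, itself fixed by the coordinate-descent pass. -/
theorem finite_fixedPoints_passMap (hn : 0 < n) (hlam : 0 ≤ lam) (hκ : 0 ≤ κ)
    (hS : (ridgeCov Y κ).PosDef) (hM : (dropIdx A i).PosDef) :
    {B | passMap Y lam κ G i B = B ∧ dropIdx B i = dropIdx A i}.Finite := by
  have hfin := finite_setOf_cdPass_eq_self (y := fun k => extData Y κ k i) hn hlam
    (pseudoPred_mulVec_injective Y G hn hκ hS hM) (pseudoPred_gram_pos Y G hn hκ hS hM)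
    (pseudoPred_mulVec_ne Y G hn hκ hS)
  refine (hfin.image fun b => replaceIdx A i
    (cdTau n (fun k => extData Y κ k i) (pseudoPred Y κ G A i) b) (Bd.extend G i b)).subset ?_
  rintro B ⟨hB, hdrop⟩
  have hpp : pseudoPred Y κ G B i = pseudoPred Y κ G A i := by
    unfold pseudoPred; rw [hdrop]
  have hcol : cdPass n (fun k => extData Y κ k i) (pseudoPred Y κ G A i) lam (bdCol G i B) =
      bdCol G i B := by
    conv_rhs => rw [← hB]
    rw [passMap, bdCol_replaceIdx, hpp]
  refine ⟨bdCol G i B, hcol, ?_⟩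
  conv_rhs => rw [← hB]
  simp only [passMap, passTau, hpp, hcol]
  exact replaceIdx_congr hdrop.symm _ _

theorem continuous_dropIdx : Continuous fun B : Matrix (Fin p) (Fin p) ℝ => dropIdx B i :=
  continuous_id.matrix_submatrix _ _

theorem continuousAt_passMap (hn : 0 < n) (hlam : 0 ≤ lam) (hκ : 0 ≤ κ)
    (hS : (ridgeCov Y κ).PosDef) (hA : A.PosDef) : ContinuousAt (passMap Y lam κ G i) A := by
  have hM := dropIdx_posDef hA i
  have hinv : Tendsto (fun B : Matrix (Fin p) (Fin p) ℝ => (dropIdx B i)⁻¹) (𝓝 A)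
      (𝓝 (dropIdx A i)⁻¹) :=
    (continuousAt_matrix_inv_of_det_ne_zero hM.det_pos.ne').tendsto.comp
      (continuous_dropIdx.tendsto A)
  have hpp : Tendsto (fun B => pseudoPred Y κ G B i) (𝓝 A) (𝓝 (pseudoPred Y κ G A i)) := by
    have hc : Continuous fun W : Matrix {j : Fin p // j ≠ i} {j : Fin p // j ≠ i} ℝ =>
        ((extData Y κ).submatrix id (Subtype.val : {j : Fin p // j ≠ i} → Fin p) * W).submatrix id
          (Bd.incl G i) := (continuous_const.matrix_mul continuous_id).matrix_submatrix _ _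
    exact (hc.tendsto _).comp hinv
  have hb : Tendsto (fun B => bdCol G i B) (𝓝 A) (𝓝 (bdCol G i A)) := by
    have hc : Continuous fun B : Matrix (Fin p) (Fin p) ℝ => bdCol G i B :=
      continuous_pi fun j => continuous_id.matrix_elem j.1 i
    exact hc.tendsto A
  have hτ : Tendsto (fun B => passTau Y κ G i B) (𝓝 A) (𝓝 (passTau Y κ G i A)) :=
    tendsto_cdTau hpp hb
  have hpass := tendsto_cdPass (y := fun k => extData Y κ k i) hn hlam
    (pseudoPred_gram_pos Y G hn hκ hS hM) (pseudoPred_mulVec_ne Y G hn hκ hS) hpp hb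
  have hs : ∀ j : {j : Fin p // j ≠ i}, Tendsto (fun B => Bd.extend G i (cdPass n
      (fun k => extData Y κ k i) (pseudoPred Y κ G B i) lam (bdCol G i B)) j) (𝓝 A)
      (𝓝 (Bd.extend G i (cdPass n (fun k => extData Y κ k i) (pseudoPred Y κ G A i) lam
        (bdCol G i A)) j)) := by
    intro j
    unfold Bd.extend
    by_cases h : G.Adj i j.1
    · simp only [h, dite_true]
      exact tendsto_pi_nhds.1 hpass _
    · simp only [h, dite_false]
      exact tendsto_const_nhds
  have hs' := tendsto_pi_nhds.2 hs
  refine tendsto_pi_nhds.2 fun a => tendsto_pi_nhds.2 fun b => ?_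
  unfold passMap
  by_cases ha : a = i
  · by_cases hb : b = i
    · subst ha; subst hb
      simp only [replaceIdx_self]
      refine hτ.add ?_
      have hc : Continuous fun q : ({j : Fin p // j ≠ b} → ℝ) ×
          Matrix {j : Fin p // j ≠ b} {j : Fin p // j ≠ b} ℝ => q.1 ⬝ᵥ (q.2 *ᵥ q.1) :=
        continuous_fst.dotProduct (continuous_snd.matrix_mulVec continuous_fst)
      exact (hc.tendsto (_, _)).comp (hs'.prodMk_nhds hinv)
    · subst ha
      have h : ∀ (B : Matrix (Fin p) (Fin p) ℝ) τ s, replaceIdx B a τ s a b = s ⟨b, hb⟩ :=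
        fun B τ s => replaceIdx_left τ s ⟨b, hb⟩
      simp only [h]
      exact hs _
  · by_cases hb : b = i
    · subst hb
      have h : ∀ (B : Matrix (Fin p) (Fin p) ℝ) τ s, replaceIdx B b τ s a b = s ⟨a, ha⟩ :=
        fun B τ s => replaceIdx_right τ s ⟨a, ha⟩
      simp only [h]
      exact hs _
    · simp only [replaceIdx_of_ne _ _ ha hb]
      exact (continuous_id.matrix_elem a b).tendsto A

/-! ### Sweeps -/

/-- Rows and columns of processed vertices have the required zeros, and later updates preserve them;
so one sweep from any positive definite matrix reaches the cone. -/
theorem IsSweep.mem_adaptedCone (hn : 0 < n) (hκ : 0 ≤ κ) (hS : (ridgeCov Y κ).PosDef)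
    (hA : A.PosDef) {A' : Matrix (Fin p) (Fin p) ℝ} (h : IsSweep Y lam κ G A A') :
    A' ∈ adaptedCone G := by
  obtain ⟨W, rfl, rfl, hW⟩ := h
  have key : ∀ k : Fin (p + 1), (W k).PosDef ∧ ∀ a b, a ≠ b → ¬ G.Adj a b →
      (a.castSucc < k ∨ b.castSucc < k) → W k a b = 0 := by
    intro k
    induction k using Fin.induction with
    | zero => exact ⟨hA, fun a b _ _ h => by simp at h⟩
    | succ k ih =>
      obtain ⟨τ, b, hτ, hk⟩ := (hW k).exists_eq_replaceIdx hn hκ hS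
      refine ⟨?_, fun x y hxy hadj h => ?_⟩
      · rw [hk]
        exact replaceIdx_posDef (dropIdx_posDef ih.1 k) hτ _
      · rw [hk]
        refine replaceIdx_extend_apply_eq_zero τ b hxy hadj ?_
        rw [or_iff_not_imp_right]
        intro hne
        push Not at hne
        refine ih.2 x y hxy hadj ?_
        rcases h with h | h
        · exact Or.inl (lt_of_le_of_ne (Fin.le_castSucc_iff.2 h)
            fun h' => hne.1 (Fin.castSucc_injective _ h'))
        · exact Or.inr (lt_of_le_of_ne (Fin.le_castSucc_iff.2 h)
            fun h' => hne.2 (Fin.castSucc_injective _ h'))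
  exact ⟨(key (Fin.last p)).1, fun a b hab hadj =>
    (key (Fin.last p)).2 a b hab hadj (Or.inl (Fin.castSucc_lt_last a))⟩

theorem mapsTo_passMap_superlevel (hn : 0 < n) (hlam : 0 ≤ lam) (hκ : 0 ≤ κ)
    (hS : (ridgeCov Y κ).PosDef) (i : Fin p) (c : ℝ) :
    Set.MapsTo (passMap Y lam κ G i) (superlevel Y lam κ G c) (superlevel Y lam κ G c) :=
  fun _ hA => ⟨passMap_mem_adaptedCone hn hκ hS hA.1,
    hA.2.trans (penObjective_passMap hn hlam hκ hS hA.1 i).1⟩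

omit [DecidableRel G.Adj] in
theorem continuousOn_penObjective_superlevel (c : ℝ) :
    ContinuousOn (penObjective Y lam κ) (superlevel Y lam κ G c) := fun _ hA =>
  (continuousAt_penObjective Y lam κ hA.1.1).continuousWithinAt

theorem IsVertexUpdate.mem_superlevel (hn : 0 < n) (hlam : 0 ≤ lam) (hκ : 0 ≤ κ)
    (hS : (ridgeCov Y κ).PosDef) {c : ℝ} (hA : A ∈ superlevel Y lam κ G c)
    {A' : Matrix (Fin p) (Fin p) ℝ} (h : IsVertexUpdate Y lam κ G i A A') :
    A' ∈ superlevel Y lam κ G c ∧ penObjective Y lam κ A ≤ penObjective Y lam κ A' :=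
  ⟨h.isOrbitOutput.mem (isCompact_superlevel Y hlam hS G c)
      (mapsTo_passMap_superlevel hn hlam hκ hS i c) hA,
    h.isOrbitOutput.le (isCompact_superlevel Y hlam hS G c)
      (mapsTo_passMap_superlevel hn hlam hκ hS i c) (continuousOn_penObjective_superlevel c)
      (fun _ hB => (penObjective_passMap hn hlam hκ hS hB.1 i).1) hA⟩

/-- The conserved quantity is `Σ_{-i,-i}`, which confines the relevant fixed points to the fibre of
the limit, where they are finitely many. -/
theorem IsVertexUpdate.tendsto_of_tendsto (hn : 0 < n) (hlam : 0 ≤ lam) (hκ : 0 ≤ κ)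
    (hS : (ridgeCov Y κ).PosDef) {ι : Type*} (U : Ultrafilter ι) {c v : ℝ}
    {As As' : ι → Matrix (Fin p) (Fin p) ℝ}
    (hAs : ∀ᶠ k in (U : Filter ι), As k ∈ superlevel Y lam κ G c) (hA : Tendsto As U (𝓝 A))
    (hstep : ∀ᶠ k in (U : Filter ι), IsVertexUpdate Y lam κ G i (As k) (As' k))
    (hv : Tendsto (fun k => penObjective Y lam κ (As k)) U (𝓝 v))
    (hv' : Tendsto (fun k => penObjective Y lam κ (As' k)) U (𝓝 v)) :
    passMap Y lam κ G i A = A ∧ Tendsto As' U (𝓝 A) := by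
  have hK := isCompact_superlevel Y hlam hS G c
  have hAK : A ∈ superlevel Y lam κ G c := hK.isClosed.mem_of_tendsto hA hAs
  refine IsOrbitOutput.tendsto_of_finite_fixedPoints (q := fun B => dropIdx B i)
    (d := fun B => ∑ j, ∑ k, |B j k - A j k|) U hK
    (mapsTo_passMap_superlevel hn hlam hκ hS i c)
    (fun B hB => (continuousAt_passMap hn hlam hκ hS hB.1.1).continuousWithinAt)
    (continuousOn_penObjective_superlevel c)
    (fun B hB => (penObjective_passMap hn hlam hκ hS hB.1 i).1)
    (fun B hB h => ((penObjective_passMap hn hlam hκ hS hB.1 i).2 h).1)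
    continuous_dropIdx (fun B => dropIdx_passMap) hAK hAs hA
    (hstep.mono fun k hk => hk.isOrbitOutput) hv hv'
    ((finite_fixedPoints_passMap hn hlam hκ hS (dropIdx_posDef hAK.1.1 i)).subset
      fun B hB => hB.2) ?_ ?_ ?_
  · exact continuous_finsetSum _ fun j _ => continuous_finsetSum _ fun k _ =>
      ((continuous_id.matrix_elem j k).sub continuous_const).abs
  · exact fun B => Finset.sum_nonneg fun j _ => Finset.sum_nonneg fun k _ => abs_nonneg _
  · intro B
    constructor
    · intro h
      ext j k
      have h1 := (Finset.sum_eq_zero_iff_of_nonneg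
        (fun j _ => Finset.sum_nonneg fun k _ => abs_nonneg _)).1 h j (Finset.mem_univ j)
      have h2 := (Finset.sum_eq_zero_iff_of_nonneg (fun k _ => abs_nonneg _)).1 h1 k
        (Finset.mem_univ k)
      exact sub_eq_zero.1 (abs_eq_zero.1 h2)
    · rintro rfl
      simp

theorem penObjective_le_of_vertexUpdates (hn : 0 < n) (hlam : 0 ≤ lam) (hκ : 0 ≤ κ)
    (hS : (ridgeCov Y κ).PosDef) (hA : A ∈ adaptedCone G) {A' : Matrix (Fin p) (Fin p) ℝ}
    {W : Fin (p + 1) → Matrix (Fin p) (Fin p) ℝ} (h0 : W 0 = A) (h1 : W (Fin.last p) = A')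
    (hW : ∀ i : Fin p, IsVertexUpdate Y lam κ G i (W i.castSucc) (W i.succ)) :
    ∀ k, W k ∈ adaptedCone G ∧ penObjective Y lam κ A ≤ penObjective Y lam κ (W k) ∧
      penObjective Y lam κ (W k) ≤ penObjective Y lam κ A' := by
  have hstep : ∀ i : Fin p, W i.castSucc ∈ adaptedCone G → W i.succ ∈ adaptedCone G ∧
      penObjective Y lam κ (W i.castSucc) ≤ penObjective Y lam κ (W i.succ) := fun i hi => by
    obtain ⟨h2, h3⟩ := (hW i).mem_superlevel hn hlam hκ hS
      (c := penObjective Y lam κ (W i.castSucc)) ⟨hi, le_rfl⟩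
    exact ⟨h2.1, h3⟩
  have hcone : ∀ k, W k ∈ adaptedCone G := by
    intro k
    induction k using Fin.induction with
    | zero => rw [h0]; exact hA
    | succ k ih => exact (hstep k ih).1
  have hmono : Monotone fun k => penObjective Y lam κ (W k) :=
    Fin.monotone_iff_le_succ.2 fun i => (hstep i (hcone _)).2
  intro k
  refine ⟨hcone k, ?_, ?_⟩
  · rw [← h0]; exact hmono (Fin.zero_le k)
  · rw [← h1]; exact hmono (Fin.le_last k)

end

/-! ### Stationarity -/

/-- The one-sided directional derivative of the absolute value. -/
def absDir (b d : ℝ) : ℝ := if b = 0 then |d| else SignType.sign b * d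

theorem tendsto_absDir (b d : ℝ) :
    Tendsto (fun t : ℝ => (|b + t * d| - |b|) / t) (𝓝[>] 0) (𝓝 (absDir b d)) := by
  unfold absDir
  split_ifs with hb
  · subst hb
    refine tendsto_const_nhds.congr' ?_
    filter_upwards [self_mem_nhdsWithin] with t ht
    have ht' : (0 : ℝ) < t := ht
    rw [zero_add, abs_zero, sub_zero, abs_mul, abs_of_pos ht']
    field_simp
  · have h1 : HasDerivAt (fun t : ℝ => b + t * d) d 0 := by
      simpa using ((hasDerivAt_id (0 : ℝ)).mul_const d).const_add b
    have h2 : HasDerivAt (fun t : ℝ => |b + t * d|) (SignType.sign b * d) 0 :=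
      HasDerivAt.comp (h₂ := abs) 0 (by simpa using hasDerivAt_abs hb) h1
    have h3 := h2.tendsto_slope_zero_right
    refine h3.congr fun t => ?_
    simp [div_eq_inv_mul]

section

attribute [local instance] Matrix.normedAddCommGroup Matrix.normedSpace

variable {n p : ℕ} (Y : Matrix (Fin n) (Fin p) ℝ) (lam κ : ℝ)

/-- The smooth part of the objective function. -/
def smoothObjective (A : Matrix (Fin p) (Fin p) ℝ) : ℝ :=
  -Real.log A.det - (A⁻¹ * ridgeCov Y κ).trace

/-- The sum of the absolute values of the off-diagonal entries. -/
def offDiagSum (A : Matrix (Fin p) (Fin p) ℝ) : ℝ :=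
  ∑ j, ∑ k, if j ≠ k then |A j k| else 0

theorem penObjective_eq_sub (A : Matrix (Fin p) (Fin p) ℝ) :
    penObjective Y lam κ A = smoothObjective Y κ A - lam * offDiagSum A :=
  penObjective_eq Y lam κ A

theorem differentiable_apply_apply (i j : Fin p) :
    Differentiable ℝ fun B : Matrix (Fin p) (Fin p) ℝ => B i j :=
  ((ContinuousLinearMap.proj (R := ℝ) (φ := fun _ : Fin p => ℝ) j).comp
    (ContinuousLinearMap.proj (R := ℝ) (φ := fun _ : Fin p => Fin p → ℝ) i)).differentiable

theorem differentiable_det_of_entries {g : Matrix (Fin p) (Fin p) ℝ → Matrix (Fin p) (Fin p) ℝ}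
    (hg : ∀ i j, Differentiable ℝ fun B => g B i j) : Differentiable ℝ fun B => (g B).det := by
  simp only [det_apply']
  refine Differentiable.fun_sum fun σ _ => Differentiable.const_mul ?_ _
  exact fun B => (HasFDerivAt.finsetProd (g := fun i B => g B (σ i) i)
    fun i _ => (hg (σ i) i B).hasFDerivAt).differentiableAt

/-- By Cramer's rule the inverse is the adjugate over the determinant, both polynomial in the
entries. -/
theorem differentiableAt_smoothObjective {A : Matrix (Fin p) (Fin p) ℝ} (hA : A.det ≠ 0) :
    DifferentiableAt ℝ (smoothObjective Y κ) A := by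
  have hdet : Differentiable ℝ fun B : Matrix (Fin p) (Fin p) ℝ => B.det :=
    differentiable_det_of_entries (g := id) differentiable_apply_apply
  have hadj : ∀ i j, Differentiable ℝ fun B : Matrix (Fin p) (Fin p) ℝ => B.adjugate i j := by
    intro i j
    simp only [adjugate_apply]
    refine differentiable_det_of_entries fun a b => ?_
    by_cases ha : a = j
    · subst ha
      simp only [updateRow_self]
      exact differentiable_const _
    · simp only [updateRow_ne ha]
      exact differentiable_apply_apply a b
  have heq : smoothObjective Y κ = fun B => -Real.log B.det -
      (B.det)⁻¹ * ∑ i, ∑ j, B.adjugate i j * ridgeCov Y κ j i := by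
    funext B
    unfold smoothObjective
    rw [inv_def, Ring.inverse_eq_inv', Matrix.smul_mul, trace_smul, smul_eq_mul]
    simp only [trace, diag_apply, mul_apply]
  rw [heq]
  refine (((hdet A).log hA).neg).sub (((hdet A).inv hA).mul ?_)
  exact (Differentiable.fun_sum fun i _ => Differentiable.fun_sum fun j _ =>
    (hadj i j).mul_const _) A

variable {Y lam κ} {G : SimpleGraph (Fin p)} [DecidableRel G.Adj] {A : Matrix (Fin p) (Fin p) ℝ}

theorem hasDerivAt_add_smul (A D : Matrix (Fin p) (Fin p) ℝ) :
    HasDerivAt (fun u : ℝ => A + u • D) D 0 :=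
  (((hasDerivAt_id (0 : ℝ)).smul_const D).const_add A).congr_deriv (one_smul ℝ D)

theorem replaceIdx_residVar_add (hA : A.IsHermitian) (i : Fin p) (u : ℝ) :
    replaceIdx A i (residVar A i + u) (fun j => A j.1 i) = A + u • single i i 1 := by
  conv_rhs => rw [← replaceIdx_residVar hA i]
  ext a b
  by_cases ha : a = i
  · by_cases hb : b = i
    · subst ha; subst hb
      simp [replaceIdx_self]; ring
    · subst ha
      simp [replaceIdx, hb, single, Ne.symm hb]
  · by_cases hb : b = i
    · subst hb
      simp [replaceIdx, ha, single, Ne.symm ha]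
    · simp [replaceIdx, ha, hb, single, Ne.symm ha]

theorem offDiagSum_replaceIdx {i : Fin p} (τ τ' : ℝ) (s s' : {j : Fin p // j ≠ i} → ℝ) :
    offDiagSum (replaceIdx A i τ s) - offDiagSum (replaceIdx A i τ' s') =
      2 * (∑ j, |s j| - ∑ j, |s' j|) := by
  unfold offDiagSum
  rw [sum_abs_replaceIdx, sum_abs_replaceIdx]
  ring

/-- Moving `τ` alone changes only the diagonal entry `(i, i)`, which the lasso penalty ignores; so
the smooth part has a local maximum along this line. -/
theorem fderiv_single_self_eq_zero (hn : 0 < n) (hlam : 0 ≤ lam) (hκ : 0 ≤ κ)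
    (hS : (ridgeCov Y κ).PosDef) (hA : A ∈ adaptedCone G) (i : Fin p)
    (hfix : passMap Y lam κ G i A = A) {L : Matrix (Fin p) (Fin p) ℝ →L[ℝ] ℝ}
    (hL : HasFDerivAt (smoothObjective Y κ) L A) : L (single i i 1) = 0 := by
  have hcurve := hasDerivAt_add_smul A (single i i (1 : ℝ))
  have hL' : HasFDerivAt (smoothObjective Y κ) L (A + (0 : ℝ) • single i i (1 : ℝ)) := by
    simpa using hL
  have hder := hL'.comp_hasDerivAt (0 : ℝ) hcurve
  refine IsLocalMax.hasDerivAt_eq_zero ?_ hder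
  have hρ := residVar_pos hA.1 i
  filter_upwards [Ioi_mem_nhds (neg_lt_zero.2 hρ)] with u hu
  have hu' : -residVar A i < u := hu
  have h1 := (penObjective_replaceIdx_le (lam := lam) hn hlam hκ hS hA i hfix).1
    (residVar A i + u) (by linarith)
  have h2 := offDiagSum_replaceIdx (A := A) (i := i) (residVar A i + u) (residVar A i)
    (fun j => A j.1 i) (fun j => A j.1 i)
  rw [replaceIdx_residVar hA.1.1] at h2
  rw [penObjective_eq_sub, penObjective_eq_sub] at h1
  have h3 : offDiagSum (replaceIdx A i (residVar A i + u) fun j => A j.1 i) = offDiagSum A := by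
    linarith
  rw [h3, replaceIdx_residVar_add hA.1.1] at h1
  simp only [Function.comp_apply, zero_smul, add_zero]
  linarith

theorem Bd.extend_update {i : Fin p} (b : Bd G i → ℝ) (j : Bd G i) (u : ℝ) :
    Bd.extend G i (Function.update b j (b j + u)) =
      Bd.extend G i b + u • Pi.single (Bd.incl G i j) 1 := by
  funext k
  by_cases hk : k ∈ Set.range (Bd.incl G i)
  · obtain ⟨l, rfl⟩ := hk
    rw [Pi.add_apply, Bd.extend_incl, Bd.extend_incl]
    by_cases hl : l = j
    · subst hl; simp
    · have : Bd.incl G i l ≠ Bd.incl G i j := fun h => hl (Bd.incl_injective G h)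
      simp [hl, this]
  · have : k ≠ Bd.incl G i j := fun h => hk ⟨j, h.symm⟩
    rw [Pi.add_apply, Bd.extend_of_notMem G _ k hk, Bd.extend_of_notMem G _ k hk]
    simp [this]

/-- At fixed `τ`, a change of one coefficient also moves the diagonal entry `τ + sᵀ (Σ_{-i,-i})⁻¹
s`, quadratically. The values of `α` and `β` play no role later. -/
theorem exists_replaceIdx_update_eq (hA : A ∈ adaptedCone G) (i : Fin p) (j : Bd G i) :
    ∃ α β : ℝ, ∀ u, replaceIdx A i (residVar A i)
      (Bd.extend G i (Function.update (bdCol G i A) j (bdCol G i A j + u))) =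
      A + u • (single i j.1 1 + single j.1 i 1) + (α * u + β * u ^ 2) • single i i 1 := by
  set s := Bd.extend G i (bdCol G i A) with hs
  set e : {j : Fin p // j ≠ i} → ℝ := Pi.single (Bd.incl G i j) 1 with he
  have hji : j.1 ≠ i := (G.ne_of_adj j.2).symm
  refine ⟨s ⬝ᵥ ((dropIdx A i)⁻¹ *ᵥ e) + e ⬝ᵥ ((dropIdx A i)⁻¹ *ᵥ s),
    e ⬝ᵥ ((dropIdx A i)⁻¹ *ᵥ e), fun u => ?_⟩
  rw [Bd.extend_update]
  conv_rhs => enter [1, 1]; rw [eq_replaceIdx_of_mem_adaptedCone hA i]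
  rw [← hs, ← he]
  ext a b
  by_cases ha : a = i
  · by_cases hb : b = i
    · subst ha; subst hb
      simp only [Matrix.add_apply, Matrix.smul_apply, replaceIdx_self, mulVec_add, mulVec_smul,
        add_dotProduct, dotProduct_add, smul_dotProduct, dotProduct_smul, smul_eq_mul,
        single_apply_same, single_apply_of_ne, ne_eq, hji, not_false_eq_true, and_false, and_true]
      ring
    · subst ha
      have h : ∀ s : {j : Fin p // j ≠ a} → ℝ, replaceIdx A a (residVar A a) s a b = s ⟨b, hb⟩ :=
        fun s => replaceIdx_left _ s ⟨b, hb⟩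
      simp only [Matrix.add_apply, Matrix.smul_apply, h, he, Pi.add_apply, Pi.smul_apply]
      by_cases hbj : b = j.1
      · subst hbj
        simp [Bd.incl, single, hji, Ne.symm hji]
      · have : (⟨b, hb⟩ : {j : Fin p // j ≠ a}) ≠ Bd.incl G a j := fun h' =>
          hbj (congrArg Subtype.val h')
        simp [this, single, Ne.symm hbj, Ne.symm hb, hji]
  · by_cases hb : b = i
    · subst hb
      have h : ∀ s : {j : Fin p // j ≠ b} → ℝ, replaceIdx A b (residVar A b) s a b = s ⟨a, ha⟩ :=
        fun s => replaceIdx_right _ s ⟨a, ha⟩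
      simp only [Matrix.add_apply, Matrix.smul_apply, h, he, Pi.add_apply, Pi.smul_apply]
      by_cases haj : a = j.1
      · subst haj
        simp [Bd.incl, single, hji, Ne.symm hji]
      · have : (⟨a, ha⟩ : {j : Fin p // j ≠ b}) ≠ Bd.incl G b j := fun h' =>
          haj (congrArg Subtype.val h')
        simp [this, single, Ne.symm haj, Ne.symm ha, hji]
    · simp [replaceIdx_of_ne _ _ ha hb, single, Ne.symm ha, Ne.symm hb]

/-- Differentiate along the curve on which one coefficient moves and `τ` stays. Its velocity has a
component along the diagonal, where the derivative vanishes. On the curve the smooth part gains at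
most the increase of the penalty, which counts the entry twice. -/
theorem fderiv_single_add_single_le (hn : 0 < n) (hlam : 0 ≤ lam) (hκ : 0 ≤ κ)
    (hS : (ridgeCov Y κ).PosDef) (hA : A ∈ adaptedCone G) (i : Fin p)
    (hfix : passMap Y lam κ G i A = A) {L : Matrix (Fin p) (Fin p) ℝ →L[ℝ] ℝ}
    (hL : HasFDerivAt (smoothObjective Y κ) L A) {j : Fin p} (hij : G.Adj i j) (d : ℝ) :
    d * L (single i j 1 + single j i 1) ≤ 2 * (lam * absDir (A i j) d) := by
  obtain ⟨α, β, hαβ⟩ := exists_replaceIdx_update_eq hA i ⟨j, hij⟩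
  have hsymm : A i j = A j i := by simpa using (hA.1.1.apply i j).symm
  simp only at hαβ
  set E := single i j (1 : ℝ) + single j i 1 with hE
  set γ : ℝ → Matrix (Fin p) (Fin p) ℝ := fun t =>
    A + (t * d) • E + (α * (t * d) + β * (t * d) ^ 2) • single i i (1 : ℝ) with hγ
  have hγ0 : γ 0 = A := by simp [hγ]
  have hlin : HasDerivAt (fun t : ℝ => t * d) d 0 := by
    simpa using (hasDerivAt_id (0 : ℝ)).mul_const d
  have hquad : HasDerivAt (fun t : ℝ => α * (t * d) + β * (t * d) ^ 2) (α * d) 0 := by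
    refine ((hlin.const_mul α).add ((hlin.pow 2).const_mul β)).congr_deriv ?_
    simp
  have hder : HasDerivAt γ (d • E + (α * d) • single i i (1 : ℝ)) 0 :=
    ((hlin.smul_const E).const_add A).add (hquad.smul_const (single i i (1 : ℝ)))
  have hval : L (d • E + (α * d) • single i i (1 : ℝ)) = d * L E := by
    rw [map_add, map_smul, map_smul, fderiv_single_self_eq_zero hn hlam hκ hS hA i hfix hL,
      smul_zero, add_zero, smul_eq_mul]
  have hcomp := ((hγ0.symm ▸ hL : HasFDerivAt (smoothObjective Y κ) L (γ 0)).comp_hasDerivAt 0 hder).congr_deriv hval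
  have hpen := ((tendsto_absDir (A i j) d).const_mul lam).const_mul 2
  refine le_of_tendsto_of_tendsto hcomp.tendsto_slope_zero_right hpen ?_
  filter_upwards [self_mem_nhdsWithin] with t ht
  have ht' : (0 : ℝ) < t := ht
  have h1 := (penObjective_replaceIdx_le (lam := lam) hn hlam hκ hS hA i hfix).2 ⟨j, hij⟩
    (bdCol G i A ⟨j, hij⟩ + t * d)
  have h2 := offDiagSum_replaceIdx (A := A) (i := i) (residVar A i) (residVar A i)
    (Bd.extend G i (Function.update (bdCol G i A) ⟨j, hij⟩ (bdCol G i A ⟨j, hij⟩ + t * d)))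
    (Bd.extend G i (bdCol G i A))
  rw [← eq_replaceIdx_of_mem_adaptedCone hA i, Bd.sum_extend G _ (fun _ x => |x|) (by simp),
    Bd.sum_extend G _ (fun _ x => |x|) (by simp),
    ← Finset.add_sum_erase _ _ (Finset.mem_univ (⟨j, hij⟩ : Bd G i)),
    ← Finset.add_sum_erase _ (fun k => |bdCol G i A k|) (Finset.mem_univ (⟨j, hij⟩ : Bd G i)),
    Function.update_self] at h2
  have h3 : ∑ k ∈ Finset.univ.erase (⟨j, hij⟩ : Bd G i),
      |Function.update (bdCol G i A) ⟨j, hij⟩ (bdCol G i A ⟨j, hij⟩ + t * d) k| =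
      ∑ k ∈ Finset.univ.erase (⟨j, hij⟩ : Bd G i), |bdCol G i A k| :=
    Finset.sum_congr rfl fun k hk => by rw [Function.update_of_ne (Finset.ne_of_mem_erase hk)]
  rw [h3] at h2
  rw [penObjective_eq_sub, penObjective_eq_sub] at h1
  rw [hαβ] at h1 h2
  have hcol : bdCol G i A ⟨j, hij⟩ = A i j := hsymm.symm
  rw [hcol] at h2
  simp only [Function.comp_apply, zero_add, hγ0, smul_eq_mul]
  change t⁻¹ * (smoothObjective Y κ (A + (t * d) • E +
    (α * (t * d) + β * (t * d) ^ 2) • single i i (1 : ℝ)) - smoothObjective Y κ A) ≤ _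
  have h4 : smoothObjective Y κ (A + (t * d) • E +
      (α * (t * d) + β * (t * d) ^ 2) • single i i (1 : ℝ)) - smoothObjective Y κ A ≤
      2 * (lam * (|A i j + t * d| - |A i j|)) := by
    have h5 : offDiagSum (A + (t * d) • E +
      (α * (t * d) + β * (t * d) ^ 2) • single i i (1 : ℝ)) =
      offDiagSum A + 2 * (|A i j + t * d| - |A i j|) := by linarith
    rw [h5] at h1
    linarith
  calc _ ≤ t⁻¹ * (2 * (lam * (|A i j + t * d| - |A i j|))) := by gcongr
    _ = _ := by ring

/-- The factor `2` matches the penalty, where each off-diagonal pair is also counted twice. -/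
theorem two_mul_apply_of_isSymm (L : Matrix (Fin p) (Fin p) ℝ →L[ℝ] ℝ)
    {D : Matrix (Fin p) (Fin p) ℝ} (hD : ∀ i j, D i j = D j i) :
    2 * L D = ∑ i, ∑ j, D i j * L (single i j 1 + single j i 1) := by
  have h1 : L D = ∑ i, ∑ j, D i j * L (single i j 1) := by
    conv_lhs => rw [matrix_eq_sum_single D]
    rw [map_sum]
    refine Finset.sum_congr rfl fun i _ => ?_
    rw [map_sum]
    refine Finset.sum_congr rfl fun j _ => ?_
    have : single i j (D i j) = D i j • single i j (1 : ℝ) := by simp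
    rw [this, map_smul, smul_eq_mul]
  have h2 : L D = ∑ i, ∑ j, D i j * L (single j i 1) := by
    rw [h1, Finset.sum_comm]
    exact Finset.sum_congr rfl fun i _ => Finset.sum_congr rfl fun j _ => by rw [hD]
  simp only [map_add, mul_add, Finset.sum_add_distrib]
  rw [← h1, ← h2]
  ring

theorem tendsto_penObjective_slope {L : Matrix (Fin p) (Fin p) ℝ →L[ℝ] ℝ}
    (hL : HasFDerivAt (smoothObjective Y κ) L A) (D : Matrix (Fin p) (Fin p) ℝ) :
    Tendsto (fun t : ℝ => (penObjective Y lam κ (A + t • D) - penObjective Y lam κ A) / t)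
      (𝓝[>] 0)
      (𝓝 (L D - lam * ∑ j, ∑ k, if j ≠ k then absDir (A j k) (D j k) else 0)) := by
  have hcurve := hasDerivAt_add_smul A D
  have hL' : HasFDerivAt (smoothObjective Y κ) L (A + (0 : ℝ) • D) := by
    simpa using hL
  have h1 := (hL'.comp_hasDerivAt (0 : ℝ) hcurve).tendsto_slope_zero_right
  have h2 : Tendsto (fun t : ℝ => ∑ j, ∑ k, if j ≠ k then
      (|A j k + t * D j k| - |A j k|) / t else 0) (𝓝[>] 0)
      (𝓝 (∑ j, ∑ k, if j ≠ k then absDir (A j k) (D j k) else 0)) := by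
    refine tendsto_finsetSum _ fun j _ => tendsto_finsetSum _ fun k _ => ?_
    by_cases h : j ≠ k
    · simp only [if_pos h]
      exact tendsto_absDir _ _
    · simp only [if_neg h]
      exact tendsto_const_nhds
  refine (h1.sub (h2.const_mul lam)).congr fun t => ?_
  have h3 : (∑ j, ∑ k, if j ≠ k then (|A j k + t * D j k| - |A j k|) / t else 0) =
      (offDiagSum (A + t • D) - offDiagSum A) / t := by
    unfold offDiagSum
    rw [← Finset.sum_sub_distrib, Finset.sum_div]
    refine Finset.sum_congr rfl fun j _ => ?_
    rw [← Finset.sum_sub_distrib, Finset.sum_div]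
    refine Finset.sum_congr rfl fun k _ => ?_
    split_ifs <;> simp
  rw [h3, penObjective_eq_sub, penObjective_eq_sub]
  simp only [Function.comp_apply, zero_add, zero_smul, add_zero, smul_eq_mul]
  ring

/-- A matrix that is unchanged by all the passes is a directional stationary point. -/
theorem isDStationaryMax_of_passMap_eq_self (hn : 0 < n) (hlam : 0 ≤ lam) (hκ : 0 ≤ κ)
    (hS : (ridgeCov Y κ).PosDef) (hA : A ∈ adaptedCone G)
    (hfix : ∀ i, passMap Y lam κ G i A = A) :
    IsDStationaryMax (penObjective Y lam κ) (adaptedCone G) A := by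
  refine ⟨hA, fun B hB => ?_⟩
  have hL := (differentiableAt_smoothObjective Y (κ := κ) hA.1.det_pos.ne').hasFDerivAt
  set L := fderiv ℝ (smoothObjective Y κ) A
  refine ⟨_, ?_, tendsto_penObjective_slope hL (B - A)⟩
  have hsymm : ∀ i j, (B - A) i j = (B - A) j i := fun i j => by
    have h1 : B j i = B i j := by simpa using hB.1.1.apply i j
    have h2 : A j i = A i j := by simpa using hA.1.1.apply i j
    simp [h1, h2]
  have h2 := two_mul_apply_of_isSymm L hsymm
  -- Non-adjacent pairs contribute nothing, as both matrices vanish there; the others are handled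
  -- one coordinate at a time.
  have h3 : ∀ i j, (B - A) i j * L (single i j 1 + single j i 1) ≤
      2 * (lam * if i ≠ j then absDir (A i j) ((B - A) i j) else 0) := by
    intro i j
    by_cases hij : i = j
    · subst hij
      rw [map_add, fderiv_single_self_eq_zero hn hlam hκ hS hA i (hfix i) hL]
      simp
    · rw [if_pos hij]
      by_cases hadj : G.Adj i j
      · exact fderiv_single_add_single_le hn hlam hκ hS hA i (hfix i) hL hadj _
      · have h4 := hA.2 i j hij hadj
        have h5 := hB.2 i j hij hadj
        simp [h4, h5, absDir]
  have h4 : 2 * L (B - A) ≤ 2 * (lam * ∑ j, ∑ k, if j ≠ k then absDir (A j k) ((B - A) j k) else 0)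
      := by
    rw [h2, Finset.mul_sum, Finset.mul_sum]
    refine Finset.sum_le_sum fun i _ => ?_
    rw [Finset.mul_sum, Finset.mul_sum]
    exact Finset.sum_le_sum fun j _ => h3 i j
  linarith

/-- Without the lasso penalty, a matrix that is unchanged by all the passes is a stationary point in
the classical sense. -/
theorem hasFDerivWithinAt_zero_of_passMap_eq_self (hn : 0 < n) (hκ : 0 ≤ κ)
    (hS : (ridgeCov Y κ).PosDef) (hA : A ∈ adaptedCone G)
    (hfix : ∀ i, passMap Y 0 κ G i A = A) :
    HasFDerivWithinAt (penObjective Y 0 κ) (0 : Matrix (Fin p) (Fin p) ℝ →L[ℝ] ℝ)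
      (adaptedCone G) A := by
  have hL := (differentiableAt_smoothObjective Y (κ := κ) hA.1.det_pos.ne').hasFDerivAt
  set L := fderiv ℝ (smoothObjective Y κ) A
  have hF : penObjective Y 0 κ = smoothObjective Y κ := by
    funext B
    rw [penObjective_eq_sub, zero_mul, sub_zero]
  have hzero : ∀ B ∈ adaptedCone G, L (B - A) = 0 := by
    intro B hB
    have hsymm : ∀ i j, (B - A) i j = (B - A) j i := fun i j => by
      have h1 : B j i = B i j := by simpa using hB.1.1.apply i j
      have h2 : A j i = A i j := by simpa using hA.1.1.apply i j
      simp [h1, h2]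
    have h2 := two_mul_apply_of_isSymm L hsymm
    have h3 : ∀ i j, (B - A) i j * L (single i j 1 + single j i 1) = 0 := by
      intro i j
      by_cases hij : i = j
      · subst hij
        rw [map_add, fderiv_single_self_eq_zero hn le_rfl hκ hS hA i (hfix i) hL]
        simp
      · by_cases hadj : G.Adj i j
        · have h4 := fderiv_single_add_single_le hn le_rfl hκ hS hA i (hfix i) hL hadj
          -- The two opposite directions give opposite inequalities, with right-hand side zero as
          -- there is no lasso penalty.
          have h5 := h4 1
          have h6 := h4 (-1)
          have h7 : L (single i j 1 + single j i 1) = 0 := by linarith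
          rw [h7, mul_zero]
        · simp [hA.2 i j hij hadj, hB.2 i j hij hadj]
    rw [Finset.sum_eq_zero fun i _ => Finset.sum_eq_zero fun j _ => h3 i j] at h2
    linarith
  rw [hF]
  -- `L` need not be zero; it vanishes on `B - A` for `B` in the cone, which is all that a
  -- derivative within the cone tests.
  refine hasFDerivWithinAt_iff_isLittleO.2 ?_
  have h8 := hasFDerivWithinAt_iff_isLittleO.1 (hL.hasFDerivWithinAt (s := adaptedCone G))
  refine h8.congr' ?_ EventuallyEq.rfl
  filter_upwards [self_mem_nhdsWithin] with B hB
  exact congrArg (fun x => smoothObjective Y κ B - smoothObjective Y κ A - x) (hzero B hB)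

end

/-! ### Convergence of the algorithm -/

section

variable {n p : ℕ} {Y : Matrix (Fin n) (Fin p) ℝ} {lam κ : ℝ} {G : SimpleGraph (Fin p)}
  [DecidableRel G.Adj] {E : ℕ → Matrix (Fin p) (Fin p) ℝ}

theorem IsGICFSequence.mem_adaptedCone (hn : 0 < n) (hκ : 0 ≤ κ) (hS : (ridgeCov Y κ).PosDef)
    (h0 : (E 0).PosDef) (hE : IsGICFSequence Y lam κ G E) (r : ℕ) : E (r + 1) ∈ adaptedCone G := by
  induction r with
  | zero => exact (hE 0).mem_adaptedCone hn hκ hS h0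
  | succ r ih => exact (hE (r + 1)).mem_adaptedCone hn hκ hS ih.1

/-- The comparison starts at `E 1`, because `E 0` may lie outside the cone. -/
theorem IsGICFSequence.monotone_penObjective (hn : 0 < n) (hlam : 0 ≤ lam) (hκ : 0 ≤ κ)
    (hS : (ridgeCov Y κ).PosDef) (h0 : (E 0).PosDef) (hE : IsGICFSequence Y lam κ G E) :
    Monotone fun r => penObjective Y lam κ (E (r + 1)) := by
  refine monotone_nat_of_le_succ fun r => ?_
  obtain ⟨W, hW0, hW1, hW⟩ := hE (r + 1)
  have h := penObjective_le_of_vertexUpdates hn hlam hκ hS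
    (hE.mem_adaptedCone hn hκ hS h0 r) hW0 hW1 hW (Fin.last p)
  exact h.2.1.trans h.2.2

theorem IsGICFSequence.exists_tendsto_penObjective (hn : 0 < n) (hlam : 0 ≤ lam) (hκ : 0 ≤ κ)
    (hS : (ridgeCov Y κ).PosDef) (h0 : (E 0).PosDef) (hE : IsGICFSequence Y lam κ G E) :
    ∃ v : ℝ, Tendsto (fun r => penObjective Y lam κ (E r)) atTop (𝓝 v) := by
  obtain ⟨M, hM⟩ := exists_penObjective_le Y hlam hS
  refine ⟨_, (tendsto_add_atTop_iff_nat 1).1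
    (tendsto_atTop_ciSup (hE.monotone_penObjective hn hlam hκ hS h0) ⟨M, ?_⟩)⟩
  rintro _ ⟨r, rfl⟩
  exact hM _ (hE.mem_adaptedCone hn hκ hS h0 r).1

theorem IsGICFSequence.passMap_eq_self (hn : 0 < n) (hlam : 0 ≤ lam) (hκ : 0 ≤ κ)
    (hS : (ridgeCov Y κ).PosDef) (h0 : (E 0).PosDef) (hE : IsGICFSequence Y lam κ G E)
    {A : Matrix (Fin p) (Fin p) ℝ} (hA : MapClusterPt A atTop E) :
    A ∈ adaptedCone G ∧ ∀ i, passMap Y lam κ G i A = A := by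
  -- Along an ultrafilter, compactness supplies limits of all auxiliary sequences without extracting
  -- further subsequences.
  obtain ⟨U, hU, hUA⟩ := mapClusterPt_iff_ultrafilter.1 hA
  obtain ⟨v, hv⟩ := hE.exists_tendsto_penObjective hn hlam hκ hS h0
  have hcone := hE.mem_adaptedCone hn hκ hS h0
  have hmono := hE.monotone_penObjective hn hlam hκ hS h0
  set c := penObjective Y lam κ (E 1) with hc
  have hEK : ∀ r, E (r + 1) ∈ superlevel Y lam κ G c := fun r => ⟨hcone r, hmono (Nat.zero_le r)⟩
  have hpos : ∀ᶠ r in (U : Filter ℕ), 0 < r := hU (eventually_gt_atTop 0)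
  choose W hW0 hW1 hW using hE
  have hWb : ∀ᶠ r in (U : Filter ℕ), ∀ k, W r k ∈ superlevel Y lam κ G c ∧
      penObjective Y lam κ (E r) ≤ penObjective Y lam κ (W r k) ∧
      penObjective Y lam κ (W r k) ≤ penObjective Y lam κ (E (r + 1)) := by
    filter_upwards [hpos] with r hr k
    obtain ⟨r, rfl⟩ := Nat.exists_eq_succ_of_ne_zero hr.ne'
    obtain ⟨h1, h2, h3⟩ := penObjective_le_of_vertexUpdates hn hlam hκ hS (hcone r)
      (hW0 (r + 1)) (hW1 (r + 1)) (hW (r + 1)) k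
    exact ⟨⟨h1, (hEK r).2.trans h2⟩, h2, h3⟩
  -- Values inside a sweep are squeezed between those at its two ends.
  have hWv : ∀ k, Tendsto (fun r => penObjective Y lam κ (W r k)) U (𝓝 v) := fun k =>
    tendsto_of_tendsto_of_tendsto_of_le_of_le' (hv.mono_left hU)
      (((tendsto_add_atTop_iff_nat 1).2 hv).mono_left hU) (hWb.mono fun r hr => (hr k).2.1)
      (hWb.mono fun r hr => (hr k).2.2)
  have hstep : ∀ i : Fin p, Tendsto (fun r => W r i.castSucc) U (𝓝 A) →
      passMap Y lam κ G i A = A ∧ Tendsto (fun r => W r i.succ) U (𝓝 A) := fun i hi =>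
    IsVertexUpdate.tendsto_of_tendsto hn hlam hκ hS U (hWb.mono fun r hr => (hr i.castSucc).1) hi
      (Eventually.of_forall fun r => hW r i) (hWv _) (hWv _)
  -- The limit propagates through the sweep: each update starts at matrices tending to `A`, so its
  -- outputs tend to `A` as well.
  have hlim : ∀ k, Tendsto (fun r => W r k) U (𝓝 A) := by
    intro k
    induction k using Fin.induction with
    | zero => simpa only [hW0] using hUA
    | succ i ih => exact (hstep i ih).2
  refine ⟨?_, fun i => (hstep i (hlim _)).1⟩
  exact ((isCompact_superlevel Y hlam hS G c).isClosed.mem_of_tendsto (hlim 0)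
    (hWb.mono fun r hr => (hr 0).1)).1

end

end

theorem proposition2 {n p : ℕ} (hn : 0 < n) (G : SimpleGraph (Fin p)) [DecidableRel G.Adj]
    (lam κ : ℝ) (hlam : 0 ≤ lam) (hκ : 0 ≤ κ) :
    -- if `κ > 0`, then `S + κ I` is positive definite, for every data matrix
    (0 < κ → ∀ Y : Matrix (Fin n) (Fin p) ℝ, (ridgeCov Y κ).PosDef) ∧
    -- if `n > p`, then `S + κ I` is positive definite almost surely
    (p < n → ∀ (Ω : Type*) [MeasurableSpace Ω] (P : Measure Ω) [IsProbabilityMeasure P]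
      (Sigma₀ : Matrix (Fin p) (Fin p) ℝ) (X : Fin n → Ω → EuclideanSpace ℝ (Fin p)),
      Sigma₀.PosDef → IsGaussianSample P Sigma₀ X →
      ∀ᵐ ω ∂P, (ridgeCov (dataMatrix X ω) κ).PosDef) ∧
    -- convergence, for every data matrix such that `S + κ I` is positive definite
    (∀ Y : Matrix (Fin n) (Fin p) ℝ, (ridgeCov Y κ).PosDef →
      ∀ E : ℕ → Matrix (Fin p) (Fin p) ℝ, (E 0).PosDef → IsGICFSequence Y lam κ G E →
        (∀ A : Matrix (Fin p) (Fin p) ℝ, MapClusterPt A atTop E →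
          IsDStationaryMax (penObjective Y lam κ) (adaptedCone G) A ∧
          (lam = 0 → HasFDerivWithinAt (penObjective Y lam κ)
            (0 : Matrix (Fin p) (Fin p) ℝ →L[ℝ] ℝ) (adaptedCone G) A)) ∧
        ∃ v : ℝ, Tendsto (fun r => penObjective Y lam κ (E r)) atTop (𝓝 v)) := by
  refine ⟨fun h Y => ridgeCov_posDef_of_pos Y h, ?_, ?_⟩
  · intro hpn Ω _ P _ S X hS hX
    exact ridgeCov_dataMatrix_posDef_ae hn hpn hκ P S X hS hX
  · intro Y hS E h0 hE
    refine ⟨fun A hA => ?_, hE.exists_tendsto_penObjective hn hlam hκ hS h0⟩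
    obtain ⟨hcone, hfix⟩ := hE.passMap_eq_self hn hlam hκ hS h0 hA
    refine ⟨isDStationaryMax_of_passMap_eq_self hn hlam hκ hS hcone hfix, ?_⟩
    rintro rfl
    exact hasFDerivWithinAt_zero_of_passMap_eq_self hn hκ hS hcone hfix
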